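/- A tree structure is a finite nonempty unranked ordered tree whose nodes interpret unary symbols; the binary symbols $\downarrow,\downarrow^+,\rightarrow,\rightarrow^+$ are interpreted as the child relation, its transitive closure, the right-sibling relation, and its transitive closure. Let $C^2[\downarrow,\downarrow^+,\rightarrow,\rightarrow^+]$ be the two-variable fragment of first-order logic with equality and counting quantifiers $\exists^{\ge n},\exists^{\le n}$ ($n\in\mathbb N$), over unary symbols and these four binary symbols. Let $$\varphi=\forall x\forall y\,\chi(x,y)\wedge\bigwedge_{i=1}^m \forall x\,\exists^{\bowtie_i C_i}y\,\chi_i(x,y),$$ where $m\ge 0$, $\bowtie_i\in\{\le,\ge\}$, $C_i\in\mathbb N$, and $\chi,\chi_i$ are quantifier-free formulas of this logic, be a formula in normal form. Let $C(\varphi)=\max_i C_i$ (with $C(\varphi)=0$ if $m=0$), and let $\boldsymbol\alpha_\varphi$ be the set of atomic $1$-types over the signature of the symbols appearing in $\varphi$, i.e. of maximal sets of atoms and negated atoms in the variable $x$ over this signature that are satisfied by some node of some tree structure. If $\varphi$ has a tree model, then it has a tree model in which every sequence of nodes $v_1,\dots,v_k$ with $v_i\downarrow v_{i+1}$ for all $i<k$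 has length $$k\le 3\,(C(\varphi)+2)^{10m+1}\,|\boldsymbol\alpha_\varphi|^2,$$ and in which every node has at most $$\bigl(4\,C(\varphi)^2+8\,C(\varphi)\bigr)\,|\boldsymbol\alpha_\varphi|^5$$ children. -/

import Mathlib

/-- The navigational binary symbols `↓`, `↓⁺`, `→`, `→⁺`. -/
inductive Nav where
  | down
  | downPlus
  | right
  | rightPlus

/-- The two variables of the logic. -/
inductive Var where
  | x
  | y

/-- Atomic formulas over the unary symbols `U` and the navigational symbols. -/
inductive Atom (U : Type*) where
  | unary (A : U) (v : Var)
  | nav (r : Nav) (v w : Var)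
  | eq (v w : Var)

/-- The formulas of the two-variable logic with counting quantifiers, with the navigational
symbols as the only binary symbols besides equality. -/
inductive Formula (U : Type*) where
  | atom (a : Atom U)
  | neg (φ : Formula U)
  | and (φ ψ : Formula U)
  | or (φ ψ : Formula U)
  | all (v : Var) (φ : Formula U)
  | ex (v : Var) (φ : Formula U)
  | existsGe (n : ℕ) (v : Var) (φ : Formula U)
  | existsLe (n : ℕ) (v : Var) (φ : Formula U)

/-- A finite unranked ordered tree, given by its nonempty finite tree domain: a node is the list
of the (0-based) indices of the children that lead to it from the root `[]`. -/
structure TreeFrame where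
  dom : Finset (List ℕ)
  root_mem : [] ∈ dom
  parent_mem : ∀ (u : List ℕ) (k : ℕ), u ++ [k] ∈ dom → u ∈ dom
  left_mem : ∀ (u : List ℕ) (k : ℕ), u ++ [k + 1] ∈ dom → u ++ [k] ∈ dom

namespace TreeFrame

/-- The nodes of a tree. -/
abbrev Node (T : TreeFrame) : Type := {u : List ℕ // u ∈ T.dom}

/-- `u ↓ w`: the node `w` is a child of `u`. -/
def Child (T : TreeFrame) (u w : T.Node) : Prop := ∃ k : ℕ, w.1 = u.1 ++ [k]

/-- `u → w`: the node `w` is the right sibling of `u`. -/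
def RightSibling (T : TreeFrame) (u w : T.Node) : Prop :=
  ∃ (p : List ℕ) (k : ℕ), u.1 = p ++ [k] ∧ w.1 = p ++ [k + 1]

/-- The interpretation of the navigational symbols. -/
def navRel (T : TreeFrame) : Nav → T.Node → T.Node → Prop
  | .down => T.Child
  | .downPlus => Relation.TransGen T.Child
  | .right => T.RightSibling
  | .rightPlus => Relation.TransGen T.RightSibling

/-- A `↓`-path `v₁, …, vₖ`: each node is followed by one of its children. -/
def IsDownPath (T : TreeFrame) (P : List T.Node) : Prop := P.IsChain T.Child

/-- The degree of a node: the number of its children. -/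
noncomputable def degree (T : TreeFrame) (v : T.Node) : ℕ := {w : T.Node | T.Child v w}.ncard

end TreeFrame

/-- A tree structure: a tree whose nodes interpret the unary symbols. -/
structure TreeStructure (U : Type*) extends TreeFrame where
  pred : U → toTreeFrame.Node → Prop

/-- The element assigned to a variable when `x ↦ a` and `y ↦ b`. -/
def Var.val {V : Type*} (a b : V) : Var → V
  | .x => a
  | .y => b

/-- Truth of an atom in `T` under `x ↦ a`, `y ↦ b`. -/
def Atom.Holds {U : Type*} (T : TreeStructure U) (a b : T.Node) : Atom U → Prop
  | .unary A v => T.pred A (v.val a b)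
  | .nav r v w => T.navRel r (v.val a b) (w.val a b)
  | .eq v w => v.val a b = w.val a b

namespace Formula

/-- Truth of a formula in `T` under `x ↦ a`, `y ↦ b`. -/
def Holds {U : Type*} (T : TreeStructure U) : Formula U → T.Node → T.Node → Prop
  | .atom p, a, b => p.Holds T a b
  | .neg φ, a, b => ¬ φ.Holds T a b
  | .and φ ψ, a, b => φ.Holds T a b ∧ ψ.Holds T a b
  | .or φ ψ, a, b => φ.Holds T a b ∨ ψ.Holds T a b
  | .all .x φ, _, b => ∀ c, φ.Holds T c b
  | .all .y φ, a, _ => ∀ c, φ.Holds T a c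
  | .ex .x φ, _, b => ∃ c, φ.Holds T c b
  | .ex .y φ, a, _ => ∃ c, φ.Holds T a c
  | .existsGe n .x φ, _, b => (n : ℕ∞) ≤ {c | φ.Holds T c b}.encard
  | .existsGe n .y φ, a, _ => (n : ℕ∞) ≤ {c | φ.Holds T a c}.encard
  | .existsLe n .x φ, _, b => {c | φ.Holds T c b}.encard ≤ (n : ℕ∞)
  | .existsLe n .y φ, a, _ => {c | φ.Holds T a c}.encard ≤ (n : ℕ∞)

/-- The formula has no quantifiers. -/
def IsQuantifierFree {U : Type*} : Formula U → Prop
  | .atom _ => True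
  | .neg φ => φ.IsQuantifierFree
  | .and φ ψ => φ.IsQuantifierFree ∧ ψ.IsQuantifierFree
  | .or φ ψ => φ.IsQuantifierFree ∧ ψ.IsQuantifierFree
  | .all _ _ => False
  | .ex _ _ => False
  | .existsGe _ _ _ => False
  | .existsLe _ _ _ => False

end Formula

/-- `T` is a model of the sentence `φ`. -/
def TreeStructure.Models {U : Type*} (T : TreeStructure U) (φ : Formula U) : Prop :=
  ∀ a b : T.Node, φ.Holds T a b

/-- `φ` has a finite tree model. -/
def Formula.Satisfiable {U : Type*} (φ : Formula U) : Prop :=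
  ∃ T : TreeStructure U, T.Models φ

/-- The symbols, other than equality, that occur in an atom. -/
def Atom.symbols {U : Type*} : Atom U → Set (U ⊕ Nav)
  | .unary A _ => {Sum.inl A}
  | .nav r _ _ => {Sum.inr r}
  | .eq _ _ => ∅

/-- The variables that occur in an atom. -/
def Atom.vars {U : Type*} : Atom U → Set Var
  | .unary _ v => {v}
  | .nav _ v w => {v, w}
  | .eq v w => {v, w}

/-- The symbols, other than equality, that appear in a formula. -/
def Formula.symbols {U : Type*} : Formula U → Set (U ⊕ Nav)
  | .atom a => a.symbols
  | .neg φ => φ.symbols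
  | .and φ ψ => φ.symbols ∪ ψ.symbols
  | .or φ ψ => φ.symbols ∪ ψ.symbols
  | .all _ φ => φ.symbols
  | .ex _ φ => φ.symbols
  | .existsGe _ _ φ => φ.symbols
  | .existsLe _ _ φ => φ.symbols

/-- The atoms and negated atoms in the variable `x` over the signature `σ`. -/
def literalsInX {U : Type*} (σ : Set (U ⊕ Nav)) : Set (Formula U) :=
  {ψ | ∃ a : Atom U, a.symbols ⊆ σ ∧ a.vars ⊆ {Var.x} ∧ (ψ = .atom a ∨ ψ = .neg (.atom a))}

/-- A set of formulas in the variable `x` is satisfied by some node of some tree. -/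
def SatisfiableInX {U : Type*} (S : Set (Formula U)) : Prop :=
  ∃ (T : TreeStructure U) (a : T.Node), ∀ ψ ∈ S, ψ.Holds T a a

/-- The atomic 1-types over `σ`: the maximal satisfiable sets of atoms or negated atoms in `x`. -/
def oneTypes {U : Type*} (σ : Set (U ⊕ Nav)) : Set (Set (Formula U)) :=
  {α | Maximal (fun S => S ⊆ literalsInX σ ∧ SatisfiableInX S) α}

/-- The two comparison signs of counting quantifiers. -/
inductive Cmp where
  | le
  | ge

/-- The data of a normal form formula
`∀x ∀y χ(x,y) ∧ ⋀_{i} ∀x ∃^{⋈_i C_i} y χ_i(x,y)`, with `m` counting conjuncts. -/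
structure NormalForm (U : Type*) where
  m : ℕ
  chi : Formula U
  chi_qf : chi.IsQuantifierFree
  cmp : Fin m → Cmp
  bound : Fin m → ℕ
  chiC : Fin m → Formula U
  chiC_qf : ∀ i, (chiC i).IsQuantifierFree

namespace NormalForm

/-- The conjunct `∀x ∃^{⋈_i C_i} y χ_i(x,y)`. -/
def conjunct {U : Type*} (φ : NormalForm U) (i : Fin φ.m) : Formula U :=
  match φ.cmp i with
  | .le => .all .x (.existsLe (φ.bound i) .y (φ.chiC i))
  | .ge => .all .x (.existsGe (φ.bound i) .y (φ.chiC i))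

/-- The normal form as a formula. -/
def toFormula {U : Type*} (φ : NormalForm U) : Formula U :=
  (List.ofFn φ.conjunct).foldl .and (.all .x (.all .y φ.chi))

/-- `C(φ)`, the largest of the numbers `C_i` (`0` if there are none). -/
def C {U : Type*} (φ : NormalForm U) : ℕ := Finset.univ.sup φ.bound

/-- The number of 1-types over the signature of the symbols that appear in the formula. -/
noncomputable def numOneTypes {U : Type*} (φ : NormalForm U) : ℕ :=
  (oneTypes φ.toFormula.symbols).ncard

end NormalForm

/-! Consider a model with as few nodes as possible. If a long path or a node with many children
contained two places that look alike, the part between them could be cut out and a smaller model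
would remain. So both bounds count how many places can look pairwise different.

A quantifier-free formula sees a pair of nodes only through their 1-types and their navigational
relations (`Agree`), and a counting conjunct sees numbers of witnesses only up to the threshold `C +
1`. A cut is therefore harmless if every pair of nodes of the new tree looks like a pair of the old
one, and if each witness lost by a surviving node leaves at least `C + 1` surviving copies: nodes of
the same type in the same relations to that node (`min_ncard_witnesses_eq`).

The vertical cut puts the subtree of a descendant `w` in the place of the subtree of `v`
(`exists_smaller_of_descendant`). Copies come from below `w`, above `v` or aside from `v`; only the
node at the cut needs a direct count of its witnesses outside and inside its subtree. The horizontal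
cut deletes consecutive siblings with their subtrees (`exists_smaller_of_siblings`). Copies come
from the siblings on either side of the gap and from below them.

The copies exist as soon as the truncated numbers of nodes of each type in these regions agree at
the two places. Along a path or a row of siblings each of these numbers moves in one direction only,
so their sum already separates the possible tuples, and the pigeonhole principle costs a factor
linear, not exponential, in the number of types (`exists_lt_map_eq_of_monotone`). -/

/-! ### Addresses -/

/-- The interpretation of the navigational symbols on addresses of nodes. -/
def Nav.rel : Nav → List ℕ → List ℕ → Prop
  | .down, u, w => ∃ k, w = u ++ [k]
  | .downPlus, u, w => u <+: w ∧ u ≠ w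
  | .right, u, w => ∃ p k, u = p ++ [k] ∧ w = p ++ [k + 1]
  | .rightPlus, u, w => ∃ p i j, i < j ∧ u = p ++ [i] ∧ w = p ++ [j]

namespace TreeFrame

theorem mem_of_append_mem (T : TreeFrame) {u : List ℕ} (t : List ℕ) :
    u ++ t ∈ T.dom → u ∈ T.dom := by
  induction t using List.reverseRecOn with
  | nil => simp
  | append_singleton t k ih =>
    intro h
    exact ih (T.parent_mem _ k (by simpa using h))

theorem sibling_mem_of_le (T : TreeFrame) {u : List ℕ} {i j : ℕ} (hij : i ≤ j) :
    u ++ [j] ∈ T.dom → u ++ [i] ∈ T.dom := by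
  induction hij with
  | refl => exact id
  | step _ ih => exact fun h => ih (T.left_mem _ _ h)

theorem transGen_child_iff (T : TreeFrame) (u w : T.Node) :
    Relation.TransGen T.Child u w ↔ u.1 <+: w.1 ∧ u.1 ≠ w.1 := by
  constructor
  · intro h
    induction h with
    | single h =>
      obtain ⟨k, hk⟩ := h
      rw [hk]; simp
    | tail _ h ih =>
      obtain ⟨k, hk⟩ := h
      obtain ⟨⟨t, ht⟩, -⟩ := ih
      rw [hk, ← ht]; simp
  · obtain ⟨u, hu⟩ := u
    obtain ⟨w, hw⟩ := w
    rintro ⟨⟨t, ht⟩, hne⟩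
    simp only at ht hne
    subst ht
    induction t using List.reverseRecOn with
    | nil => simp at hne
    | append_singleton t k ih =>
      have hm : u ++ t ∈ T.dom := T.parent_mem _ k (by simpa using hw)
      have hc : T.Child ⟨u ++ t, hm⟩ ⟨u ++ (t ++ [k]), hw⟩ := ⟨k, by simp⟩
      by_cases ht : t = []
      · subst ht
        exact .single ⟨k, by simp⟩
      · exact .tail (ih hm (by simpa using ht)) hc

theorem transGen_rightSibling_iff (T : TreeFrame) (u w : T.Node) :
    Relation.TransGen T.RightSibling u w ↔
      ∃ p i j, i < j ∧ u.1 = p ++ [i] ∧ w.1 = p ++ [j] := by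
  constructor
  · intro h
    induction h with
    | single h =>
      obtain ⟨p, k, h1, h2⟩ := h
      exact ⟨p, k, k + 1, by simp, h1, h2⟩
    | tail _ h ih =>
      obtain ⟨p, k, h1, h2⟩ := h
      obtain ⟨q, i, j, hij, hi, hj⟩ := ih
      obtain ⟨rfl, hk⟩ := List.append_inj' (h1.symm.trans hj) rfl
      simp only [List.cons.injEq, and_true] at hk
      exact ⟨p, i, k + 1, by omega, hi, h2⟩
  · obtain ⟨u, hu⟩ := u
    obtain ⟨w, hw⟩ := w
    rintro ⟨p, i, j, hij, rfl, rfl⟩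
    induction hij with
    | refl => exact .single ⟨p, i, rfl, rfl⟩
    | step _ ih =>
      exact .tail (ih (T.left_mem _ _ hw)) ⟨p, _, rfl, rfl⟩

/-- Transitive closures become prefix and index comparisons, so relations can be computed on
addresses alone and compared between different trees. -/
theorem navRel_iff (T : TreeFrame) (r : Nav) (u w : T.Node) :
    T.navRel r u w ↔ r.rel u.1 w.1 := by
  cases r
  · rfl
  · exact T.transGen_child_iff u w
  · rfl
  · exact T.transGen_rightSibling_iff u w

end TreeFrame

theorem Nav.not_rel_self (r : Nav) (u : List ℕ) : ¬ r.rel u u := by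
  cases r
  · simp [Nav.rel]
  · simp [Nav.rel]
  · rintro ⟨p, k, h1, h2⟩
    simpa using h1.symm.trans h2
  · rintro ⟨p, i, j, hij, h1, h2⟩
    have := h1.symm.trans h2
    simp at this
    omega

/-- Two pairs of addresses are in the same navigational relations. -/
def SameRel (u u' a a' : List ℕ) : Prop :=
  (u = u' ↔ a = a') ∧ ∀ r : Nav, (r.rel u u' ↔ r.rel a a') ∧ (r.rel u' u ↔ r.rel a' a)

namespace SameRel

theorem refl (u u' : List ℕ) : SameRel u u' u u' := by simp [SameRel]

theorem symm {u u' a a' : List ℕ} (h : SameRel u u' a a') : SameRel a a' u u' :=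
  ⟨h.1.symm, fun r => ⟨(h.2 r).1.symm, (h.2 r).2.symm⟩⟩

theorem trans {u u' a a' b b' : List ℕ} (h : SameRel u u' a a') (h' : SameRel a a' b b') :
    SameRel u u' b b' :=
  ⟨h.1.trans h'.1, fun r => ⟨(h.2 r).1.trans (h'.2 r).1, (h.2 r).2.trans (h'.2 r).2⟩⟩

theorem swap {u u' a a' : List ℕ} (h : SameRel u u' a a') : SameRel u' u a' a :=
  ⟨eq_comm.trans (h.1.trans eq_comm), fun r => ⟨(h.2 r).2, (h.2 r).1⟩⟩

end SameRel

/-! ### Types and truth of quantifier-free formulas -/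

section Types

variable {U : Type*} (σ : Set (U ⊕ Nav))

/-- The 1-type over `σ` of a node. -/
def TreeStructure.tp (T : TreeStructure U) (v : T.Node) : Set (Formula U) :=
  {ψ | ψ ∈ literalsInX σ ∧ ψ.Holds T v v}

variable {σ}

theorem TreeStructure.pred_iff_of_tp_eq {T T' : TreeStructure U} {u : T'.Node} {a : T.Node}
    (h : T'.tp σ u = T.tp σ a) {A : U} (hA : Sum.inl A ∈ σ) : T'.pred A u ↔ T.pred A a := by
  have key : ∀ {T : TreeStructure U} (v : T.Node),
      Formula.atom (.unary A .x) ∈ T.tp σ v ↔ T.pred A v := by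
    intro T v
    refine ⟨fun h => h.2, fun h => ⟨⟨.unary A .x, ?_, ?_, Or.inl rfl⟩, h⟩⟩
    · simpa [Atom.symbols] using hA
    · simp [Atom.vars]
  rw [← key, ← key, h]

/-- At a single node every navigational atom is false and every equality is true, so only unary
atoms can distinguish two nodes. -/
theorem TreeStructure.tp_eq_of_pred_iff {T T' : TreeStructure U} {u : T'.Node} {a : T.Node}
    (h : ∀ A, Sum.inl A ∈ σ → (T'.pred A u ↔ T.pred A a)) : T'.tp σ u = T.tp σ a := by
  have key : ∀ p : Atom U, p.symbols ⊆ σ → (p.Holds T' u u ↔ p.Holds T a a) := by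
    rintro (⟨A, v⟩ | ⟨r, v, w⟩ | ⟨v, w⟩) hp
    · have := h A (by simpa [Atom.symbols] using hp)
      cases v <;> simpa [Atom.Holds, Var.val] using this
    · cases v <;> cases w <;>
        simp [Atom.Holds, Var.val, TreeFrame.navRel_iff, Nav.not_rel_self]
    · cases v <;> cases w <;> simp [Atom.Holds, Var.val]
  ext ψ
  refine and_congr_right ?_
  rintro ⟨p, hp, -, rfl | rfl⟩
  · exact key p hp
  · exact not_congr (key p hp)

/-- The literals true at a node decide every atom in `x`. A satisfiable superset cannot contain
another literal, because the opposite one is already present. -/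
theorem TreeStructure.tp_mem_oneTypes (T : TreeStructure U) (v : T.Node) :
    T.tp σ v ∈ oneTypes σ := by
  refine ⟨⟨fun ψ h => h.1, T, v, fun ψ h => h.2⟩, ?_⟩
  rintro S ⟨hS, T', a, ha⟩ hle ψ hψ
  refine ⟨hS hψ, ?_⟩
  by_contra hn
  obtain ⟨p, hp, hx, rfl | rfl⟩ := hS hψ
  · have : Formula.neg (.atom p) ∈ T.tp σ v := ⟨⟨p, hp, hx, Or.inr rfl⟩, hn⟩
    exact ha _ (hle this) (ha _ hψ)
  · have : Formula.atom p ∈ T.tp σ v := ⟨⟨p, hp, hx, Or.inl rfl⟩, not_not.1 hn⟩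
    exact ha _ hψ (ha _ (hle this))

/-- Finitely many symbols give finitely many literals in the single variable `x`. Without finiteness
the `ncard` in `numOneTypes` would be the default value `0`. -/
theorem oneTypes_finite (hσ : σ.Finite) : (oneTypes σ).Finite := by
  have hlit : (literalsInX σ).Finite := by
    have hat : {a : Atom U | a.symbols ⊆ σ ∧ a.vars ⊆ {Var.x}}.Finite := by
      let f : Option (U ⊕ Nav) → Atom U := fun o => match o with
        | none => .eq .x .x
        | some (.inl A) => .unary A .x
        | some (.inr r) => .nav r .x .x
      refine (((hσ.image some).insert none).image f).subset ?_
      rintro (⟨A, v⟩ | ⟨r, v, w⟩ | ⟨v, w⟩) ⟨h1, h2⟩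
      · obtain rfl : v = .x := by simpa [Atom.vars] using h2
        exact ⟨some (.inl A), by simpa [Atom.symbols] using h1, rfl⟩
      · obtain ⟨rfl, rfl⟩ : v = .x ∧ w = .x := by simpa [Atom.vars, Set.insert_subset_iff] using h2
        exact ⟨some (.inr r), by simpa [Atom.symbols] using h1, rfl⟩
      · obtain ⟨rfl, rfl⟩ : v = .x ∧ w = .x := by simpa [Atom.vars, Set.insert_subset_iff] using h2
        exact ⟨none, by simp, rfl⟩
    refine ((hat.image Formula.atom).union (hat.image fun a => .neg (.atom a))).subset ?_
    rintro ψ ⟨a, h1, h2, rfl | rfl⟩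
    · exact Or.inl ⟨a, ⟨h1, h2⟩, rfl⟩
    · exact Or.inr ⟨a, ⟨h1, h2⟩, rfl⟩
  exact hlit.finite_subsets.subset fun α h => h.1.1

theorem Formula.symbols_finite (φ : Formula U) : φ.symbols.Finite := by
  induction φ with
  | atom a => cases a <;> simp [Formula.symbols, Atom.symbols]
  | neg φ ih => exact ih
  | and φ ψ h1 h2 => exact h1.union h2
  | or φ ψ h1 h2 => exact h1.union h2
  | all v φ ih => exact ih
  | ex v φ ih => exact ih
  | existsGe n v φ ih => exact ih
  | existsLe n v φ ih => exact ih

variable (σ) in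
/-- Two pairs of nodes satisfy the same atoms over `σ`. -/
def Agree (T' : TreeStructure U) (u u' : T'.Node) (T : TreeStructure U) (a a' : T.Node) : Prop :=
  ∀ p : Atom U, p.symbols ⊆ σ → (p.Holds T' u u' ↔ p.Holds T a a')

/-- The types settle the unary atoms, the atoms that repeat a variable have constant truth values,
and `SameRel` settles the rest. -/
theorem Agree.of_tp_eq {T T' : TreeStructure U} {u u' : T'.Node} {a a' : T.Node}
    (h : T'.tp σ u = T.tp σ a) (h' : T'.tp σ u' = T.tp σ a') (hr : SameRel u.1 u'.1 a.1 a'.1) :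
    Agree σ T' u u' T a a' := by
  rintro (⟨A, v⟩ | ⟨r, v, w⟩ | ⟨v, w⟩) hp
  · have hA : Sum.inl A ∈ σ := by simpa [Atom.symbols] using hp
    cases v
    · exact TreeStructure.pred_iff_of_tp_eq h hA
    · exact TreeStructure.pred_iff_of_tp_eq h' hA
  · have := hr.2 r
    cases v <;> cases w <;>
      simp [Atom.Holds, Var.val, TreeFrame.navRel_iff, Nav.not_rel_self, this.1, this.2]
  · have h₁ : u = u' ↔ a = a' := by rw [Subtype.ext_iff, Subtype.ext_iff]; exact hr.1
    have h₂ : u' = u ↔ a' = a := by rw [eq_comm, h₁, eq_comm]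
    cases v <;> cases w <;> simp [Atom.Holds, Var.val, h₁, h₂]

theorem Agree.holds_iff {T T' : TreeStructure U} {u u' : T'.Node} {a a' : T.Node}
    (h : Agree σ T' u u' T a a') {χ : Formula U} (hq : χ.IsQuantifierFree)
    (hχ : χ.symbols ⊆ σ) : χ.Holds T' u u' ↔ χ.Holds T a a' := by
  induction χ with
  | atom p => exact h p hχ
  | neg φ ih => exact not_congr (ih hq hχ)
  | and φ ψ h1 h2 =>
    exact and_congr (h1 hq.1 (Set.subset_union_left.trans hχ))
      (h2 hq.2 (Set.subset_union_right.trans hχ))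
  | or φ ψ h1 h2 =>
    exact or_congr (h1 hq.1 (Set.subset_union_left.trans hχ))
      (h2 hq.2 (Set.subset_union_right.trans hχ))
  | all v φ ih => exact hq.elim
  | ex v φ ih => exact hq.elim
  | existsGe n v φ ih => exact hq.elim
  | existsLe n v φ ih => exact hq.elim

theorem Agree.trans {T₁ T₂ T₃ : TreeStructure U} {u₁ v₁ : T₁.Node} {u₂ v₂ : T₂.Node}
    {u₃ v₃ : T₃.Node} (h : Agree σ T₁ u₁ v₁ T₂ u₂ v₂) (h' : Agree σ T₂ u₂ v₂ T₃ u₃ v₃) :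
    Agree σ T₁ u₁ v₁ T₃ u₃ v₃ :=
  fun p hp => (h p hp).trans (h' p hp)

/-- If the witnesses of `u` embed into those of `a` and each lost witness has more than `C`
surviving copies, then the numbers of witnesses agree up to the threshold `C + 1`. -/
theorem min_ncard_witnesses_eq {T T' : TreeStructure U} {u : T'.Node} {a : T.Node} {C : ℕ}
    (f : T'.Node → T.Node) (hf : f.Injective)
    (hagree : ∀ u', Agree σ T' u u' T a (f u'))
    (hmiss : ∀ z : T.Node, z ∉ Set.range f →
      ∃ X : Set T.Node, C + 1 ≤ X.ncard ∧ ∀ x ∈ X, x ∈ Set.range f ∧ Agree σ T a x T a z)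
    {χ : Formula U} (hq : χ.IsQuantifierFree) (hχ : χ.symbols ⊆ σ) :
    min (C + 1) {u' | χ.Holds T' u u'}.ncard = min (C + 1) {a' | χ.Holds T a a'}.ncard := by
  have himg : f '' {u' | χ.Holds T' u u'} ⊆ {a' | χ.Holds T a a'} := by
    rintro _ ⟨u', hu', rfl⟩
    exact ((hagree u').holds_iff hq hχ).1 hu'
  have hcard := Set.ncard_image_of_injective {u' | χ.Holds T' u u'} hf
  -- Either no witness is lost and `f` matches the two witness sets, or one lost witness brings `C +
  -- 1` surviving copies and both truncated counts equal `C + 1`.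
  by_cases h : {a' | χ.Holds T a a'} ⊆ Set.range f
  · have : f '' {u' | χ.Holds T' u u'} = {a' | χ.Holds T a a'} := by
      refine himg.antisymm fun z hz => ?_
      obtain ⟨u', rfl⟩ := h hz
      exact ⟨u', ((hagree u').holds_iff hq hχ).2 hz, rfl⟩
    rw [← hcard, this]
  · obtain ⟨z, hz, hzr⟩ := Set.not_subset.1 h
    obtain ⟨X, hX, hXz⟩ := hmiss z hzr
    have hsub : X ⊆ f '' {u' | χ.Holds T' u u'} := by
      intro x hx
      obtain ⟨⟨u', rfl⟩, hxz⟩ := hXz x hx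
      exact ⟨u', (((hagree u').trans hxz).holds_iff hq hχ).2 hz, rfl⟩
    have h1 := Set.ncard_le_ncard hsub (Set.toFinite _)
    have h2 := Set.ncard_le_ncard himg (Set.toFinite _)
    omega

end Types

/-! ### Normal forms -/

namespace Formula

variable {U : Type*}

theorem holds_foldl_and (T : TreeStructure U) (L : List (Formula U)) (ψ : Formula U)
    (a b : T.Node) :
    (L.foldl .and ψ).Holds T a b ↔ ψ.Holds T a b ∧ ∀ θ ∈ L, θ.Holds T a b := by
  induction L generalizing ψ with
  | nil => simp
  | cons θ L ih => simp [ih, Holds, and_assoc]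

theorem symbols_foldl_and (L : List (Formula U)) (ψ : Formula U) :
    (L.foldl .and ψ).symbols = ψ.symbols ∪ {s | ∃ θ ∈ L, s ∈ θ.symbols} := by
  induction L generalizing ψ with
  | nil => simp
  | cons θ L ih =>
    rw [List.foldl_cons, ih]
    ext s
    simp [symbols, or_assoc]

end Formula

/-- Comparison of a number with a bound. -/
def Cmp.Sat : Cmp → ℕ → ℕ → Prop
  | .le, c, n => n ≤ c
  | .ge, c, n => c ≤ n

namespace NormalForm

variable {U : Type*} (φ : NormalForm U)

theorem bound_le_C (i : Fin φ.m) : φ.bound i ≤ φ.C :=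
  Finset.le_sup (f := φ.bound) (Finset.mem_univ i)

theorem chi_symbols_subset : φ.chi.symbols ⊆ φ.toFormula.symbols := by
  rw [toFormula, Formula.symbols_foldl_and]
  exact Set.subset_union_left

theorem chiC_symbols_subset (i : Fin φ.m) : (φ.chiC i).symbols ⊆ φ.toFormula.symbols := by
  rw [toFormula, Formula.symbols_foldl_and]
  refine fun s hs => Or.inr ⟨φ.conjunct i, by simp [List.mem_ofFn], ?_⟩
  unfold conjunct
  cases φ.cmp i <;> exact hs

theorem models_iff (T : TreeStructure U) :
    T.Models φ.toFormula ↔ (∀ a b, φ.chi.Holds T a b) ∧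
      ∀ i a, (φ.cmp i).Sat (φ.bound i) {b | (φ.chiC i).Holds T a b}.ncard := by
  have hc : ∀ i a b, (φ.conjunct i).Holds T a b ↔
      ∀ a, (φ.cmp i).Sat (φ.bound i) {b | (φ.chiC i).Holds T a b}.ncard := by
    intro i a b
    unfold conjunct
    cases φ.cmp i <;>
      simp only [Formula.Holds, Cmp.Sat, ← (Set.toFinite _).cast_ncard_eq, Nat.cast_le]
  have hr : Nonempty T.Node := ⟨⟨[], T.root_mem⟩⟩
  simp only [TreeStructure.Models, toFormula, Formula.holds_foldl_and, List.mem_ofFn,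
    Formula.Holds, forall_exists_index, forall_apply_eq_imp_iff, hc, forall_const]

variable {φ}

/-- `T'` is a model if its pairs of nodes look like pairs of `T`, and its nodes have, up to the
threshold, as many witnesses as nodes of `T`. -/
theorem models_of_agree {T T' : TreeStructure U} (hT : T.Models φ.toFormula)
    (hpair : ∀ u u' : T'.Node, ∃ a a' : T.Node, Agree φ.toFormula.symbols T' u u' T a a')
    (hcount : ∀ (u : T'.Node) i, ∃ a : T.Node,
      min (φ.C + 1) {b | (φ.chiC i).Holds T' u b}.ncard =
        min (φ.C + 1) {b | (φ.chiC i).Holds T a b}.ncard) :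
    T'.Models φ.toFormula := by
  rw [models_iff] at hT ⊢
  refine ⟨fun u u' => ?_, fun i u => ?_⟩
  · obtain ⟨a, a', h⟩ := hpair u u'
    exact (h.holds_iff φ.chi_qf φ.chi_symbols_subset).2 (hT.1 a a')
  · obtain ⟨a, h⟩ := hcount u i
    have h1 := hT.2 i a
    have h2 := φ.bound_le_C i
    -- Numbers that agree after truncation at `C + 1` compare in the same way with every bound that
    -- is at most `C`.
    cases hc : φ.cmp i <;> simp only [hc, Cmp.Sat] at h1 ⊢ <;> omega

end NormalForm

/-! ### Pigeonhole -/

/-- Among sufficiently many indices, two have the same key and the same values of given monotone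
bounded functions. -/
theorem exists_lt_map_eq_of_monotone {κ ι : Type*} [Fintype κ] [Fintype ι] {n B : ℕ}
    (key : Fin n → κ) (q : ι → Fin n → ℕ) (hq : ∀ i, Monotone (q i)) (hB : ∀ i j, q i j ≤ B)
    (hn : Fintype.card κ * (Fintype.card ι * B + 1) < n) :
    ∃ a b, a < b ∧ key a = key b ∧ ∀ i, q i a = q i b := by
  -- The sum stands in for the whole tuple: it takes at most `card ι * B + 1` values.
  have hΦ : ∀ j, ∑ i, q i j < Fintype.card ι * B + 1 := fun j =>
    Nat.lt_succ_of_le ((Finset.sum_le_sum fun i _ => hB i j).trans (by simp))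
  obtain ⟨a, b, hab, h⟩ := Fintype.exists_ne_map_eq_of_card_lt
    (fun j => ((key j, ⟨∑ i, q i j, hΦ j⟩) : κ × Fin (Fintype.card ι * B + 1))) (by simpa using hn)
  wlog hlt : a < b generalizing a b
  · exact this b a hab.symm h.symm (lt_of_le_of_ne (not_lt.1 hlt) hab.symm)
  simp only [Prod.mk.injEq, Fin.mk.injEq] at h
  refine ⟨a, b, hlt, h.1, fun i => ?_⟩
  -- By monotonicity the tuples at `a` and `b` are comparable termwise, so equal sums force equal
  -- terms.
  exact (Finset.sum_eq_sum_iff_of_le fun i _ => hq i hlt.le).1 h.2 i (Finset.mem_univ i)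

/-! ### Navigational relations and common prefixes -/

namespace Nav

@[simp] theorem down_nil_right (u : List ℕ) : ¬ Nav.down.rel u [] := by simp [rel]

@[simp] theorem down_nil_cons (y : ℕ) (w : List ℕ) : Nav.down.rel [] (y :: w) ↔ w = [] := by
  simp [rel]

@[simp] theorem down_cons_cons (x y : ℕ) (u w : List ℕ) :
    Nav.down.rel (x :: u) (y :: w) ↔ x = y ∧ Nav.down.rel u w := by
  simp [rel, eq_comm]

@[simp] theorem downPlus_nil_right (u : List ℕ) : ¬ Nav.downPlus.rel u [] := by
  simp [rel]

@[simp] theorem downPlus_nil_cons (y : ℕ) (w : List ℕ) : Nav.downPlus.rel [] (y :: w) := by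
  simp [rel]

@[simp] theorem downPlus_cons_cons (x y : ℕ) (u w : List ℕ) :
    Nav.downPlus.rel (x :: u) (y :: w) ↔ x = y ∧ Nav.downPlus.rel u w := by
  simp only [rel, List.cons_prefix_cons, ne_eq, List.cons.injEq]
  tauto

@[simp] theorem right_nil_right (u : List ℕ) : ¬ Nav.right.rel u [] := by simp [rel]

@[simp] theorem right_nil_left (u : List ℕ) : ¬ Nav.right.rel [] u := by simp [rel]

@[simp] theorem right_cons_cons (x y : ℕ) (u w : List ℕ) :
    Nav.right.rel (x :: u) (y :: w) ↔
      (u = [] ∧ w = [] ∧ y = x + 1) ∨ (x = y ∧ Nav.right.rel u w) := by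
  constructor
  · rintro ⟨p, k, h1, h2⟩
    cases p with
    | nil => simp_all
    | cons z p =>
      simp only [List.cons_append, List.cons.injEq] at h1 h2
      exact Or.inr ⟨h1.1.trans h2.1.symm, p, k, h1.2, h2.2⟩
  · rintro (⟨rfl, rfl, rfl⟩ | ⟨rfl, p, k, rfl, rfl⟩)
    · exact ⟨[], x, rfl, rfl⟩
    · exact ⟨x :: p, k, rfl, rfl⟩

@[simp] theorem rightPlus_nil_right (u : List ℕ) : ¬ Nav.rightPlus.rel u [] := by simp [rel]

@[simp] theorem rightPlus_nil_left (u : List ℕ) : ¬ Nav.rightPlus.rel [] u := by simp [rel]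

@[simp] theorem rightPlus_cons_cons (x y : ℕ) (u w : List ℕ) :
    Nav.rightPlus.rel (x :: u) (y :: w) ↔
      (u = [] ∧ w = [] ∧ x < y) ∨ (x = y ∧ Nav.rightPlus.rel u w) := by
  constructor
  · rintro ⟨p, i, j, hij, h1, h2⟩
    cases p with
    | nil => simp_all
    | cons z p =>
      simp only [List.cons_append, List.cons.injEq] at h1 h2
      exact Or.inr ⟨h1.1.trans h2.1.symm, p, i, j, hij, h1.2, h2.2⟩
  · rintro (⟨rfl, rfl, hxy⟩ | ⟨rfl, p, i, j, hij, rfl, rfl⟩)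
    · exact ⟨[], x, y, hxy, rfl, rfl⟩
    · exact ⟨x :: p, i, j, hij, rfl, rfl⟩

end Nav

/-- Two addresses that are distinct and in no navigational relation. -/
def Unrelated (u w : List ℕ) : Prop := u ≠ w ∧ ∀ r : Nav, ¬ r.rel u w ∧ ¬ r.rel w u

namespace Unrelated

theorem sameRel {u w a b : List ℕ} (h : Unrelated u w) (h' : Unrelated a b) :
    SameRel u w a b :=
  ⟨iff_of_false h.1 h'.1, fun r =>
    ⟨iff_of_false (h.2 r).1 (h'.2 r).1, iff_of_false (h.2 r).2 (h'.2 r).2⟩⟩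

end Unrelated

namespace SameRel

/-- Navigational relations depend only on what follows a common prefix. -/
theorem cons_cons (x : ℕ) (s s' : List ℕ) : SameRel (x :: s) (x :: s') s s' := by
  refine ⟨by simp, fun r => ?_⟩
  cases r <;> simp

theorem cons_congr {x : ℕ} {s s' t t' : List ℕ} (h : SameRel s s' t t') :
    SameRel (x :: s) (x :: s') (x :: t) (x :: t') :=
  (cons_cons x s s').trans (h.trans (cons_cons x t t').symm)

theorem append_append (p s s' : List ℕ) : SameRel (p ++ s) (p ++ s') s s' := by
  induction p with
  | nil => exact .refl _ _
  | cons x p ih => exact (cons_cons x _ _).trans ih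

theorem append_append_append (p q s s' : List ℕ) :
    SameRel (p ++ s) (p ++ s') (q ++ s) (q ++ s') :=
  (append_append p s s').trans (append_append q s s').symm

/-- A node that is not below `v` sees all strict descendants of `v` in the same way. -/
theorem of_not_prefix {v u x z : List ℕ} (hu : ¬ v <+: u) (hx : x ≠ []) (hz : z ≠ []) :
    SameRel u (v ++ x) u (v ++ z) := by
  induction v generalizing u with
  | nil => simp at hu
  | cons y v ih =>
    cases u with
    -- Both addresses on the right have length at least 2, so they are proper descendants of the
    -- root but not its children.
    | nil =>
      refine ⟨by simp, fun r => ?_⟩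
      cases r <;> simp [hx, hz]
    | cons c u =>
      by_cases hc : y = c
      · subst hc
        exact cons_congr (ih (by simpa using hu))
      · refine ⟨by simp [Ne.symm hc], fun r => ?_⟩
        cases r <;> simp [hx, hz, hc, Ne.symm hc]

/-- A node sees all its ancestors, except for its parent, in the same way. -/
theorem of_length {x z s s' : List ℕ} (hs : 2 ≤ s.length) (hs' : 2 ≤ s'.length)
    (h : x ++ s = z ++ s') : SameRel (x ++ s) x (x ++ s) z := by
  have h1 : SameRel (x ++ s) x s [] := by simpa using append_append x s []
  have h2 : SameRel (z ++ s') z s' [] := by simpa using append_append z s' []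
  have h3 : SameRel s [] s' [] := by
    match s, s', hs, hs' with
    | a :: b :: s, a' :: b' :: s', _, _ =>
      refine ⟨by simp, fun r => ?_⟩
      cases r <;> simp
  have := h1.trans (h3.trans h2.symm)
  rwa [← h] at this

end SameRel

/-- A strict descendant of `w` is unrelated to each node that is incomparable with `w`. -/
theorem Unrelated.of_incomparable {w x t : List ℕ} (h : ¬ w <+: x) (h' : ¬ x <+: w)
    (ht : t ≠ []) : Unrelated (w ++ t) x := by
  induction w generalizing x with
  | nil => simp at h
  | cons y w ih =>
    cases x with
    | nil => simp at h'
    | cons c x =>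
      by_cases hc : y = c
      · subst hc
        have := ih (by simpa using h) (by simpa using h')
        refine ⟨by simpa using this.1, fun r => ?_⟩
        have h2 := this.2 r
        have h3 := (SameRel.cons_cons y (w ++ t) x).2 r
        rwa [← h3.1, ← h3.2] at h2
      · refine ⟨by simp [hc], fun r => ?_⟩
        cases r <;> simp [ht, hc, Ne.symm hc]

/-! ### Removing a part of a tree -/

/-- Apply `f` to the part of an address that follows the prefix `v`. -/
def liftAt (v : List ℕ) (f : List ℕ → List ℕ) (u : List ℕ) : List ℕ :=
  if v <+: u then v ++ f (u.drop v.length) else u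

section LiftAt

variable {v : List ℕ} {f : List ℕ → List ℕ}

@[simp] theorem liftAt_append (t : List ℕ) : liftAt v f (v ++ t) = v ++ f t := by
  simp [liftAt]

theorem liftAt_of_not_prefix {u : List ℕ} (h : ¬ v <+: u) : liftAt v f u = u := by
  simp [liftAt, h]

theorem prefix_liftAt_iff {u : List ℕ} : v <+: liftAt v f u ↔ v <+: u := by
  by_cases h : v <+: u
  · obtain ⟨t, rfl⟩ := h
    simp
  · simp [liftAt_of_not_prefix h]

theorem liftAt_injective (hf : f.Injective) : (liftAt v f).Injective := by
  intro a b hab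
  have hp : v <+: a ↔ v <+: b := by
    rw [← prefix_liftAt_iff (f := f), hab, prefix_liftAt_iff]
  by_cases h : v <+: a
  · obtain ⟨t, rfl⟩ := h
    obtain ⟨t', rfl⟩ := hp.1 ⟨t, rfl⟩
    simp only [liftAt_append, List.append_cancel_left_eq] at hab
    rw [hf hab]
  · rwa [liftAt_of_not_prefix h, liftAt_of_not_prefix (fun h' => h (hp.2 h'))] at hab

end LiftAt

namespace TreeFrame

/-- The tree whose nodes are the addresses that `g` maps to nodes of `T`. -/
noncomputable def comap (T : TreeFrame) (g : List ℕ → List ℕ) (hg : g.Injective)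
    (hroot : g [] ∈ T.dom)
    (hparent : ∀ u k, g (u ++ [k]) ∈ T.dom → g u ∈ T.dom)
    (hleft : ∀ u k, g (u ++ [k + 1]) ∈ T.dom → g (u ++ [k]) ∈ T.dom) : TreeFrame where
  dom := T.dom.preimage g hg.injOn
  root_mem := Finset.mem_preimage.2 hroot
  parent_mem u k h := Finset.mem_preimage.2 (hparent u k (Finset.mem_preimage.1 h))
  left_mem u k h := Finset.mem_preimage.2 (hleft u k (Finset.mem_preimage.1 h))

theorem mem_comap {T : TreeFrame} {g : List ℕ → List ℕ} {hg : g.Injective}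
    {hroot : g [] ∈ T.dom} {hparent : ∀ u k, g (u ++ [k]) ∈ T.dom → g u ∈ T.dom}
    {hleft : ∀ u k, g (u ++ [k + 1]) ∈ T.dom → g (u ++ [k]) ∈ T.dom} {u : List ℕ} :
    u ∈ (T.comap g hg hroot hparent hleft).dom ↔ g u ∈ T.dom :=
  Finset.mem_preimage (hf := hg.injOn)

end TreeFrame

namespace TreeStructure

variable {U : Type*}

/-- `T'` is obtained from `T` by renaming the nodes along `g`. -/
structure IsComap (T' T : TreeStructure U) (g : List ℕ → List ℕ) : Prop where
  mem_iff : ∀ u, u ∈ T'.dom ↔ g u ∈ T.dom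
  pred_iff : ∀ A (u : T'.Node), T'.pred A u ↔ T.pred A ⟨g u.1, (mem_iff u.1).1 u.2⟩

/-- Both cuts are pullbacks along an injection from new addresses to old ones. Injectivity keeps the
domain finite; the other hypotheses are the closure conditions of a tree domain. -/
theorem exists_isComap (T : TreeStructure U) (g : List ℕ → List ℕ) (hg : g.Injective)
    (hroot : g [] ∈ T.dom)
    (hparent : ∀ u k, g (u ++ [k]) ∈ T.dom → g u ∈ T.dom)
    (hleft : ∀ u k, g (u ++ [k + 1]) ∈ T.dom → g (u ++ [k]) ∈ T.dom) :
    ∃ T' : TreeStructure U, T'.IsComap T g := by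
  have hmem : ∀ u, u ∈ (T.toTreeFrame.comap g hg hroot hparent hleft).dom ↔ g u ∈ T.dom :=
    fun _ => TreeFrame.mem_comap
  exact ⟨⟨T.toTreeFrame.comap g hg hroot hparent hleft,
    fun A u => T.pred A ⟨g u.1, (hmem u.1).1 u.2⟩⟩, hmem, fun _ _ => Iff.rfl⟩

namespace IsComap

variable {T' T : TreeStructure U} {g : List ℕ → List ℕ}

/-- The map on nodes induced by `g`. -/
def node (h : T'.IsComap T g) (u : T'.Node) : T.Node := ⟨g u.1, (h.mem_iff u.1).1 u.2⟩

theorem tp_node (h : T'.IsComap T g) (σ : Set (U ⊕ Nav)) (u : T'.Node) :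
    T'.tp σ u = T.tp σ (h.node u) :=
  tp_eq_of_pred_iff fun A _ => h.pred_iff A u

theorem node_injective (h : T'.IsComap T g) (hg : g.Injective) : h.node.Injective :=
  fun _ _ huv => Subtype.ext (hg (congrArg Subtype.val huv))

theorem mem_range_node (h : T'.IsComap T g) {x : T.Node} (u : List ℕ) (hu : g u = x.1) :
    x ∈ Set.range h.node :=
  ⟨⟨u, (h.mem_iff u).2 (hu ▸ x.2)⟩, Subtype.ext hu⟩

theorem card_lt (h : T'.IsComap T g) (hg : g.Injective) {z : List ℕ} (hz : z ∈ T.dom)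
    (hzg : z ∉ Set.range g) : T'.dom.card < T.dom.card := by
  classical
  rw [← Finset.card_image_of_injective T'.dom hg]
  refine Finset.card_lt_card ⟨fun x hx => ?_, fun hsub => ?_⟩
  · obtain ⟨u, hu, rfl⟩ := Finset.mem_image.1 hx
    exact (h.mem_iff u).1 hu
  · obtain ⟨u, -, hu⟩ := Finset.mem_image.1 (hsub hz)
    exact hzg ⟨u, hu⟩

end IsComap

/-- The number of nodes of type `α` with an address in `S`. -/
noncomputable def count (T : TreeStructure U) (σ : Set (U ⊕ Nav)) (S : Set (List ℕ))
    (α : Set (Formula U)) : ℕ := {z : T.Node | z.1 ∈ S ∧ T.tp σ z = α}.ncard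

variable {T : TreeStructure U} {σ : Set (U ⊕ Nav)}

theorem count_mono {S S' : Set (List ℕ)} (h : S ⊆ S') (α : Set (Formula U)) :
    T.count σ S α ≤ T.count σ S' α :=
  Set.ncard_le_ncard (fun _ hz => ⟨h hz.1, hz.2⟩) (Set.toFinite _)

/-- A set that is not exhausted by a subset with the same truncated number of nodes of each type:
the subset contains many nodes of the type of each missing node. -/
theorem lt_count_of_min_eq {S S' : Set (List ℕ)} (h : S ⊆ S') {C : ℕ} {z : T.Node}
    (heq : min (C + 1) (T.count σ S (T.tp σ z)) = min (C + 1) (T.count σ S' (T.tp σ z)))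
    (hz : z.1 ∈ S') (hz' : z.1 ∉ S) : C + 1 ≤ T.count σ S (T.tp σ z) := by
  -- The node `z` makes the inclusion strict, so the truncated counts can only agree if both have
  -- reached `C + 1`.
  have : T.count σ S (T.tp σ z) < T.count σ S' (T.tp σ z) := by
    refine Set.ncard_lt_ncard ⟨fun _ hx => ⟨h hx.1, hx.2⟩, fun hsub => ?_⟩ (Set.toFinite _)
    exact hz' (hsub ⟨hz, rfl⟩).1
  omega

end TreeStructure

/-! ### Short paths -/

section Paths

theorem prefix_antisymm {v w : List ℕ} (h : v <+: w) (h' : w <+: v) : v = w :=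
  h.eq_of_length_le h'.length_le

/-- The strict descendants of `w`. -/
def below (w : List ℕ) : Set (List ℕ) := {z | w <+: z ∧ z ≠ w}

/-- The strict ancestors of `w`. -/
def above (w : List ℕ) : Set (List ℕ) := {z | z <+: w ∧ z ≠ w}

/-- The addresses that are incomparable with `w`. -/
def aside (w : List ℕ) : Set (List ℕ) := {z | ¬ w <+: z ∧ ¬ z <+: w}

/-- The regions `below`, `above` and `aside` vary monotonically along a downward path, as the
pigeonhole argument requires. -/
theorem below_anti {v w : List ℕ} (h : v <+: w) : below w ⊆ below v := by
  rintro z ⟨hz, hne⟩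
  refine ⟨h.trans hz, ?_⟩
  rintro rfl
  exact hne (prefix_antisymm h hz)

theorem above_mono {v w : List ℕ} (h : v <+: w) : above v ⊆ above w := by
  rintro z ⟨hz, hne⟩
  refine ⟨hz.trans h, ?_⟩
  rintro rfl
  exact hne (prefix_antisymm hz h)

theorem aside_mono {v w : List ℕ} (h : v <+: w) : aside v ⊆ aside w := by
  rintro z ⟨hz, hz'⟩
  refine ⟨fun hw => hz (h.trans hw), fun hw => ?_⟩
  rcases List.prefix_or_prefix_of_prefix h hw with h' | h'
  · exact hz h'
  · exact hz' h'

variable {U : Type*} {φ : NormalForm U} {T : TreeStructure U}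

/-- The number of witnesses of a node that are not below it. -/
noncomputable def outerCount (φ : NormalForm U) (T : TreeStructure U) (i : Fin φ.m)
    (v : T.Node) : ℕ := {u : T.Node | ¬ v.1 <+: u.1 ∧ (φ.chiC i).Holds T v u}.ncard

/-- A node `v` can be replaced by a strict descendant `v ++ s` of the same type that has, up to the
threshold, the same surroundings. -/
theorem exists_smaller_of_descendant (hT : T.Models φ.toFormula) {v s : List ℕ} (hs : s ≠ [])
    (hv : v ∈ T.dom) (hw : v ++ s ∈ T.dom)
    (htp : T.tp φ.toFormula.symbols ⟨v, hv⟩ = T.tp φ.toFormula.symbols ⟨v ++ s, hw⟩)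
    (hout : ∀ i, min (φ.C + 1) (outerCount φ T i ⟨v, hv⟩) =
      min (φ.C + 1) (outerCount φ T i ⟨v ++ s, hw⟩))
    (hbelow : ∀ z : T.Node,
      min (φ.C + 1) (T.count φ.toFormula.symbols (below (v ++ s)) (T.tp φ.toFormula.symbols z)) =
      min (φ.C + 1) (T.count φ.toFormula.symbols (below v) (T.tp φ.toFormula.symbols z)))
    (habove : ∀ z : T.Node,
      min (φ.C + 1) (T.count φ.toFormula.symbols (above v) (T.tp φ.toFormula.symbols z)) =
      min (φ.C + 1) (T.count φ.toFormula.symbols (above (v ++ s)) (T.tp φ.toFormula.symbols z)))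
    (haside : ∀ z : T.Node,
      min (φ.C + 1) (T.count φ.toFormula.symbols (aside v) (T.tp φ.toFormula.symbols z)) =
      min (φ.C + 1) (T.count φ.toFormula.symbols (aside (v ++ s)) (T.tp φ.toFormula.symbols z))) :
    ∃ T' : TreeStructure U, T'.Models φ.toFormula ∧ T'.dom.card < T.dom.card := by
  classical
  set σ := φ.toFormula.symbols with hσ
  -- The map sends a new address to the old address of the same node: the new `v` carries the old
  -- subtree of `v ++ s`.
  set g : List ℕ → List ℕ := liftAt v (s ++ ·) with hg_def
  have hg : g.Injective := liftAt_injective fun a b hab => by simpa using hab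
  have hg_app : ∀ t, g (v ++ t) = v ++ s ++ t := fun t => by simp [hg_def]
  have hgv : g v = v ++ s := by simpa using hg_app []
  have hg_not : ∀ {u}, ¬ v <+: u → g u = u := fun h => liftAt_of_not_prefix h
  have hvg : v ∉ Set.range g := by
    rintro ⟨u, hu⟩
    by_cases h : v <+: u
    · obtain ⟨t, rfl⟩ := h
      rw [hg_app] at hu
      simp [hs] at hu
    · rw [hg_not h] at hu
      exact h (hu ▸ List.prefix_rfl)
  have hsnoc : ∀ {u : List ℕ} {k : ℕ}, ¬ v <+: u → v ≠ u ++ [k] → g (u ++ [k]) = u ++ [k] := by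
    intro u k h h'
    refine hg_not fun hp => ?_
    rcases List.prefix_concat_iff.1 (by simpa using hp) with h1 | h1
    · exact h' (by simpa using h1)
    · exact h h1
  obtain ⟨T', hT'⟩ := T.exists_isComap g hg
    (by
      by_cases h : v <+: []
      · obtain rfl : v = [] := by simpa using h
        rw [hgv]; exact hw
      · rw [hg_not h]; exact T.root_mem)
    (by
      intro u k h
      by_cases hu : v <+: u
      · obtain ⟨t, rfl⟩ := hu
        rw [List.append_assoc, hg_app, ← List.append_assoc] at h
        rw [hg_app]
        exact T.parent_mem _ k h
      · rw [hg_not hu]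
        by_cases hk : v = u ++ [k]
        · exact T.parent_mem _ k (hk ▸ hv)
        · rw [hsnoc hu hk] at h
          exact T.parent_mem _ k h)
    (by
      intro u k h
      by_cases hu : v <+: u
      · obtain ⟨t, rfl⟩ := hu
        rw [List.append_assoc, hg_app, ← List.append_assoc] at h ⊢
        exact T.left_mem _ k h
      · have hmem : u ++ [k] ∈ T.dom := by
          by_cases hk : v = u ++ [k + 1]
          · exact T.left_mem _ k (hk ▸ hv)
          · rw [hsnoc hu hk] at h
            exact T.left_mem _ k h
        by_cases hk : v = u ++ [k]
        · rw [← hk, hgv]; exact hw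
        · rwa [hsnoc hu hk])
  refine ⟨T', ?_, hT'.card_lt hg hv hvg⟩
  set γ := hT'.node with hγ
  have hγ_val : ∀ u, (γ u).1 = g u.1 := fun _ => rfl
  -- Nodes outside the subtree must see the cut node in the position of the old `v`, not of `v ++
  -- s`, to which they may be related differently. The equal types permit this.
  let η : T'.Node → T.Node := fun u => if u.1 = v then ⟨v, hv⟩ else γ u
  have hη_v : ∀ {u : T'.Node}, u.1 = v → η u = ⟨v, hv⟩ := fun h => if_pos h
  have hη_ne : ∀ {u : T'.Node}, u.1 ≠ v → η u = γ u := fun h => if_neg h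
  have htp_v : ∀ {u : T'.Node}, u.1 = v → T'.tp σ u = T.tp σ ⟨v, hv⟩ := by
    intro u hu
    rw [hT'.tp_node σ u, htp]
    congr 1
    exact Subtype.ext ((congrArg g hu).trans hgv)
  have htp_η : ∀ u, T'.tp σ u = T.tp σ (η u) := by
    intro u
    by_cases hu : u.1 = v
    · rw [hη_v hu, htp_v hu]
    · rw [hη_ne hu, hT'.tp_node σ u]
  have hη : η.Injective := by
    intro a b hab
    by_cases ha : a.1 = v <;> by_cases hb : b.1 = v
    · exact Subtype.ext (ha.trans hb.symm)
    · rw [hη_v ha, hη_ne hb] at hab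
      exact (hvg ⟨b.1, (congrArg Subtype.val hab).symm⟩).elim
    · rw [hη_v hb, hη_ne ha] at hab
      exact (hvg ⟨a.1, congrArg Subtype.val hab⟩).elim
    · rw [hη_ne ha, hη_ne hb] at hab
      exact hT'.node_injective hg hab
  have hη_range : ∀ {x : T.Node} (y : List ℕ), g y = x.1 → y ≠ v → x ∈ Set.range η := by
    intro x y hy hne
    obtain ⟨u, hu⟩ := hT'.mem_range_node y hy
    have huy : u.1 = y := hg ((congrArg Subtype.val hu).trans hy.symm)
    exact ⟨u, by rw [hη_ne (huy ▸ hne)]; exact hu⟩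
  have hη_below : ∀ {x : T.Node}, x.1 ∈ below (v ++ s) → x ∈ Set.range η := by
    rintro x ⟨⟨t, ht⟩, hne⟩
    refine hη_range (v ++ t) (by rw [hg_app, ht]) ?_
    intro h
    obtain rfl : t = [] := by simpa using h
    exact hne (by simpa using ht.symm)
  -- The three kinds of nodes of `T'`.
  have hrel_not : ∀ {u u' : T'.Node}, ¬ v <+: u.1 → SameRel u.1 u'.1 (γ u).1 (η u').1 := by
    intro u u' hu
    rw [hγ_val, hg_not hu]
    by_cases h : u'.1 = v
    · rw [hη_v h, h]
      exact .refl _ _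
    · rw [hη_ne h, hγ_val]
      by_cases hp : v <+: u'.1
      · obtain ⟨t, ht⟩ := hp
        rw [← ht, hg_app, List.append_assoc]
        refine SameRel.of_not_prefix hu ?_ (by simp [hs])
        rintro rfl
        exact h (by simpa using ht.symm)
      · rw [hg_not hp]
        exact .refl _ _
  have hrel_ge : ∀ {u u' : T'.Node}, v <+: u.1 → v <+: u'.1 →
      SameRel u.1 u'.1 (γ u).1 (γ u').1 := by
    rintro u u' ⟨t, ht⟩ ⟨t', ht'⟩
    rw [hγ_val, hγ_val, ← ht, ← ht', hg_app, hg_app]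
    exact .append_append_append _ _ _ _
  have hrel_gt : ∀ {u u' : T'.Node}, v <+: u.1 → u.1 ≠ v →
      SameRel u.1 u'.1 (γ u).1 (γ u').1 := by
    intro u u' hu hne
    by_cases h : v <+: u'.1
    · exact hrel_ge hu h
    · obtain ⟨t, ht⟩ := hu
      rw [hγ_val, hγ_val, ← ht, hg_app, hg_not h, List.append_assoc]
      refine (SameRel.of_not_prefix h ?_ (by simp [hs])).swap
      rintro rfl
      exact hne (by simpa using ht.symm)
  have hagree_v : ∀ {u u' : T'.Node}, u.1 = v → ¬ v <+: u'.1 →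
      Agree σ T' u u' T ⟨v, hv⟩ (γ u') := by
    intro u u' hu hu'
    refine .of_tp_eq (htp_v hu) (hT'.tp_node σ u') ?_
    rw [hγ_val, hg_not hu', hu]
    exact .refl _ _
  have hagree_ge : ∀ {u u' : T'.Node}, v <+: u.1 → v <+: u'.1 →
      Agree σ T' u u' T (γ u) (γ u') := fun hu hu' =>
    .of_tp_eq (hT'.tp_node σ _) (hT'.tp_node σ _) (hrel_ge hu hu')
  refine NormalForm.models_of_agree hT (fun u u' => ?_) (fun u i => ?_)
  · by_cases hu : v <+: u.1
    · by_cases hu' : v <+: u'.1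
      · exact ⟨_, _, hagree_ge hu hu'⟩
      · by_cases hne : u.1 = v
        · exact ⟨_, _, hagree_v hne hu'⟩
        · exact ⟨γ u, γ u', .of_tp_eq (hT'.tp_node σ u) (hT'.tp_node σ u') (hrel_gt hu hne)⟩
    · exact ⟨γ u, η u', .of_tp_eq (hT'.tp_node σ u) (htp_η u') (hrel_not hu)⟩
  refine ⟨γ u, ?_⟩
  by_cases hu : v <+: u.1
  · by_cases hne : u.1 = v
    -- The cut node has the surroundings of the old `v` and the subtree of `v ++ s`. Its inner
    -- witnesses correspond exactly to those of `v ++ s`; its outer ones are those of `v`, and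
    -- `hout` equates their truncated number with that for `v ++ s`.
    · have hγu : γ u = ⟨v ++ s, hw⟩ := Subtype.ext ((congrArg g hne).trans hgv)
      have hγ_inj := hT'.node_injective hg
      have h1 : ({b | (φ.chiC i).Holds T' u b} ∩ {b | v <+: b.1}).ncard =
          ({b | (φ.chiC i).Holds T (γ u) b} ∩ {b | v ++ s <+: b.1}).ncard := by
        rw [← Set.ncard_image_of_injective _ hγ_inj]
        congr 1
        ext x
        constructor
        · rintro ⟨b, ⟨hb, hvb⟩, rfl⟩
          refine ⟨((hagree_ge hu hvb).holds_iff (φ.chiC_qf i) (φ.chiC_symbols_subset i)).1 hb, ?_⟩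
          obtain ⟨t, ht⟩ := hvb
          exact ⟨t, by rw [hγ_val, ← ht, hg_app]⟩
        · rintro ⟨hx, t, ht⟩
          obtain ⟨b, rfl⟩ := hT'.mem_range_node (v ++ t) ((hg_app t).trans ht)
          have hvb : v <+: b.1 := ⟨t, hg ((hg_app t).trans ht)⟩
          exact ⟨b, ⟨((hagree_ge hu hvb).holds_iff (φ.chiC_qf i)
            (φ.chiC_symbols_subset i)).2 hx, hvb⟩, rfl⟩
      have h2 : ({b | (φ.chiC i).Holds T' u b} \ {b | v <+: b.1}).ncard =
          outerCount φ T i ⟨v, hv⟩ := by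
        rw [← Set.ncard_image_of_injective _ hγ_inj, outerCount]
        congr 1
        ext x
        constructor
        · rintro ⟨b, ⟨hb, hvb⟩, rfl⟩
          refine ⟨?_, ((hagree_v hne hvb).holds_iff (φ.chiC_qf i)
            (φ.chiC_symbols_subset i)).1 hb⟩
          rw [hγ_val, hg_not hvb]
          exact hvb
        · rintro ⟨hx, hx'⟩
          obtain ⟨b, rfl⟩ := hT'.mem_range_node x.1 (hg_not hx)
          have hb : ¬ v <+: b.1 := by
            rw [hγ_val] at hx
            rwa [← prefix_liftAt_iff (f := (s ++ ·))]
          exact ⟨b, ⟨((hagree_v hne hb).holds_iff (φ.chiC_qf i)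
            (φ.chiC_symbols_subset i)).2 hx', hb⟩, rfl⟩
      have h3 : ({b | (φ.chiC i).Holds T (γ u) b} \ {b | v ++ s <+: b.1}).ncard =
          outerCount φ T i ⟨v ++ s, hw⟩ := by
        rw [hγu, outerCount]
        congr 1
        ext x
        exact and_comm
      have h4 := hout i
      have h5 := Set.ncard_inter_add_ncard_sdiff_eq_ncard
        {b | (φ.chiC i).Holds T' u b} {b | v <+: b.1} (Set.toFinite _)
      have h6 := Set.ncard_inter_add_ncard_sdiff_eq_ncard
        {b | (φ.chiC i).Holds T (γ u) b} {b | v ++ s <+: b.1} (Set.toFinite _)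
      omega
    · refine min_ncard_witnesses_eq (σ := σ) γ (hT'.node_injective hg)
        (fun u' => .of_tp_eq (hT'.tp_node σ u) (hT'.tp_node σ u') (hrel_gt hu hne)) ?_
        (φ.chiC_qf i) (φ.chiC_symbols_subset i)
      intro z hz
      obtain ⟨t, ht⟩ := hu
      have ht0 : t ≠ [] := by
        rintro rfl
        exact hne (by simpa using ht.symm)
      have hγu : (γ u).1 = v ++ s ++ t := by rw [hγ_val, ← ht, hg_app]
      have hvz : v <+: z.1 := by
        by_contra h
        exact hz (hT'.mem_range_node z.1 (hg_not h))
      have hwz : ¬ v ++ s <+: z.1 := by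
        rintro ⟨t', ht'⟩
        exact hz (hT'.mem_range_node (v ++ t') ((hg_app t').trans ht'))
      -- Here `u` lies strictly below the cut. A lost ancestor is at distance at least 2, like every
      -- strict ancestor of `v`, and a lost node incomparable with `v ++ s` is unrelated to `u`,
      -- like every node aside from `v`.
      by_cases hzw : z.1 <+: v ++ s
      · have hzv : z.1 ∉ above v := fun h => h.2 (prefix_antisymm h.1 hvz)
        refine ⟨{x : T.Node | x.1 ∈ above v ∧ T.tp σ x = T.tp σ z},
          T.lt_count_of_min_eq (above_mono ⟨s, rfl⟩) (habove z)
            ⟨hzw, fun h => hwz (h ▸ List.prefix_rfl)⟩ hzv, ?_⟩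
        rintro x ⟨⟨⟨r, hr⟩, hxv⟩, hxz⟩
        refine ⟨hT'.mem_range_node x.1 (hg_not fun h => hxv (prefix_antisymm ⟨r, hr⟩ h)),
          .of_tp_eq rfl hxz ?_⟩
        obtain ⟨r', hr'⟩ := hzw
        have hr0 : r ≠ [] := by
          rintro rfl
          exact hxv (by simpa using hr)
        have hr0' : r' ≠ [] := by
          rintro rfl
          exact hwz ⟨[], by simpa using hr'.symm⟩
        have e1 : (γ u).1 = x.1 ++ (r ++ s ++ t) := by rw [hγu, ← hr]; simp
        have e2 : (γ u).1 = z.1 ++ (r' ++ t) := by rw [hγu, ← hr']; simp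
        rw [e1]
        refine SameRel.of_length ?_ ?_ (e1.symm.trans e2)
        all_goals
          have := List.length_pos_iff.2 hr0
          have := List.length_pos_iff.2 hr0'
          have := List.length_pos_iff.2 ht0
          simp only [List.length_append]
          omega
      · refine ⟨{x : T.Node | x.1 ∈ aside v ∧ T.tp σ x = T.tp σ z},
          T.lt_count_of_min_eq (aside_mono ⟨s, rfl⟩) (haside z) ⟨hwz, hzw⟩ fun h => h.1 hvz, ?_⟩
        rintro x ⟨hx, hxz⟩
        refine ⟨hT'.mem_range_node x.1 (hg_not hx.1), .of_tp_eq rfl hxz ?_⟩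
        rw [hγu]
        have hx' := aside_mono (List.prefix_append v s) hx
        exact (Unrelated.of_incomparable hx'.1 hx'.2 ht0).sameRel
          (Unrelated.of_incomparable hwz hzw ht0)
  -- For `u` outside the subtree, all strict descendants of `v` look alike. The lost ones, among
  -- them `v ++ s` itself because of `η`, are replaced by strict descendants of `v ++ s`.
  · refine min_ncard_witnesses_eq (σ := σ) η hη
      (fun u' => .of_tp_eq (hT'.tp_node σ u) (htp_η u') (hrel_not hu)) ?_
      (φ.chiC_qf i) (φ.chiC_symbols_subset i)
    intro z hz
    have hvz : v <+: z.1 := by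
      by_contra h
      exact hz (hη_range z.1 (hg_not h) fun h' => h (h' ▸ List.prefix_rfl))
    have hzv : z.1 ≠ v := by
      intro h
      refine hz ⟨⟨v, (hT'.mem_iff v).2 (by rw [hgv]; exact hw)⟩, ?_⟩
      rw [hη_v rfl]
      exact Subtype.ext h.symm
    refine ⟨{x : T.Node | x.1 ∈ below (v ++ s) ∧ T.tp σ x = T.tp σ z},
      T.lt_count_of_min_eq (below_anti ⟨s, rfl⟩) (hbelow z) ⟨hvz, hzv⟩
        (fun h => hz (hη_below h)), ?_⟩
    rintro x ⟨hx, hxz⟩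
    refine ⟨hη_below hx, .of_tp_eq rfl hxz ?_⟩
    rw [hγ_val, hg_not hu]
    obtain ⟨⟨t, ht⟩, hne⟩ := below_anti (List.prefix_append v s) hx
    obtain ⟨t', ht'⟩ := hvz
    rw [← ht, ← ht']
    refine SameRel.of_not_prefix hu ?_ ?_
    · rintro rfl
      exact hne (by simpa using ht.symm)
    · rintro rfl
      exact hzv (by simpa using ht'.symm)

/-- In a smallest model, paths are short. -/
theorem length_le_of_isDownPath (hT : T.Models φ.toFormula)
    (hmin : ∀ T' : TreeStructure U, T'.Models φ.toFormula → T.dom.card ≤ T'.dom.card)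
    {P : List T.Node} (hP : T.IsDownPath P) :
    P.length ≤ 3 * (φ.C + 2) ^ (10 * φ.m + 1) * φ.numOneTypes ^ 2 := by
  classical
  by_contra! hlong
  set σ := φ.toFormula.symbols with hσ
  have hfin := oneTypes_finite (Formula.symbols_finite φ.toFormula)
  let _ : Fintype (oneTypes σ) := hfin.fintype
  have hN : Fintype.card (oneTypes σ) = φ.numOneTypes := by
    rw [NormalForm.numOneTypes, ← Nat.card_coe_set_eq, Nat.card_eq_fintype_card]
  have hpre : ∀ {a b : Fin P.length}, a ≤ b → P[a].1 <+: P[b].1 := by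
    intro a b hab
    have htr : P.Pairwise (fun u w : T.Node => u.1 <+: w.1) := by
      have : P.IsChain (fun u w : T.Node => u.1 <+: w.1) :=
        hP.imp fun _ _ ⟨k, hk⟩ => ⟨[k], hk.symm⟩
      have _ : IsTrans T.Node (fun u w : T.Node => u.1 <+: w.1) := ⟨fun _ _ _ => List.IsPrefix.trans⟩
      exact List.isChain_iff_pairwise.1 ‹_›
    rcases hab.eq_or_lt with rfl | hlt
    · exact List.prefix_rfl
    · exact List.pairwise_iff_getElem.1 htr a b a.2 b.2 hlt
  have hne : ∀ {a b : Fin P.length}, a < b → P[a].1 ≠ P[b].1 := by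
    intro a b hab
    have htr : P.Pairwise (fun u w : T.Node => u.1.length < w.1.length) := by
      have : P.IsChain (fun u w : T.Node => u.1.length < w.1.length) :=
        hP.imp fun _ _ ⟨k, hk⟩ => by simp [hk]
      have _ : IsTrans T.Node (fun u w : T.Node => u.1.length < w.1.length) :=
        ⟨fun _ _ _ => lt_trans⟩
      exact List.isChain_iff_pairwise.1 ‹_›
    intro h
    exact (List.pairwise_iff_getElem.1 htr a b a.2 b.2 hab).ne (congrArg List.length h)
  let key : Fin P.length → oneTypes σ × (Fin φ.m → Fin (φ.C + 2)) := fun j =>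
    (⟨T.tp σ P[j], T.tp_mem_oneTypes _⟩,
      fun i => ⟨min (φ.C + 1) (outerCount φ T i P[j]), by omega⟩)
  -- The counts below decrease along the path, so they are reversed to make all three families
  -- monotone.
  let q : Fin 3 × oneTypes σ → Fin P.length → ℕ := fun p j =>
    match p with
    | (0, α) => φ.C + 1 - min (φ.C + 1) (T.count σ (below P[j].1) α)
    | (1, α) => min (φ.C + 1) (T.count σ (above P[j].1) α)
    | (2, α) => min (φ.C + 1) (T.count σ (aside P[j].1) α)
  obtain ⟨a, b, hab, hkey, hq⟩ := exists_lt_map_eq_of_monotone (B := φ.C + 1) key q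
    (by
      rintro ⟨k, α⟩ a b hab
      fin_cases k
      · exact Nat.sub_le_sub_left (min_le_min_left _ (T.count_mono (below_anti (hpre hab)) _)) _
      · exact min_le_min_left _ (T.count_mono (above_mono (hpre hab)) _)
      · exact min_le_min_left _ (T.count_mono (aside_mono (hpre hab)) _))
    (by
      rintro ⟨k, α⟩ j
      fin_cases k
      · exact Nat.sub_le _ _
      · exact min_le_left _ _
      · exact min_le_left _ _)
    (by
      refine lt_of_le_of_lt ?_ hlong
      have hN1 : 1 ≤ φ.numOneTypes := by
        rw [← hN]
        exact Fintype.card_pos_iff.2 ⟨⟨_, T.tp_mem_oneTypes ⟨[], T.root_mem⟩⟩⟩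
      simp only [Fintype.card_prod, Fintype.card_fun, Fintype.card_fin, hN]
      have h1 : 3 * φ.numOneTypes * (φ.C + 1) + 1 ≤ 3 * φ.numOneTypes * (φ.C + 2) := by
        nlinarith
      -- The argument needs only the exponent `m + 1`; the larger exponent is slack.
      have h2 : (φ.C + 2) ^ φ.m ≤ (φ.C + 2) ^ (10 * φ.m) :=
        Nat.pow_le_pow_right (by omega) (by omega)
      calc φ.numOneTypes * (φ.C + 2) ^ φ.m * (3 * φ.numOneTypes * (φ.C + 1) + 1)
          ≤ φ.numOneTypes * (φ.C + 2) ^ (10 * φ.m) * (3 * φ.numOneTypes * (φ.C + 2)) := by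
            gcongr
        _ = 3 * (φ.C + 2) ^ (10 * φ.m + 1) * φ.numOneTypes ^ 2 := by ring)
  obtain ⟨s, hs⟩ := hpre hab.le
  have hw : P[a].1 ++ s ∈ T.dom := by rw [hs]; exact P[b].2
  have hwb : (⟨P[a].1 ++ s, hw⟩ : T.Node) = P[b] := Subtype.ext hs
  simp only [key, Prod.mk.injEq, Subtype.mk.injEq, funext_iff, Fin.mk.injEq] at hkey
  have hq' : ∀ k (z : T.Node), q (k, ⟨T.tp σ z, T.tp_mem_oneTypes z⟩) a =
    q (k, ⟨T.tp σ z, T.tp_mem_oneTypes z⟩) b := fun k z => hq _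
  obtain ⟨T', hT', hlt⟩ := exists_smaller_of_descendant hT (v := P[a].1) (s := s)
    (by
      rintro rfl
      exact hne hab (by simpa using hs))
    P[a].2 hw (by rw [hwb]; exact hkey.1) (by rw [hwb]; exact hkey.2)
    (by
      intro z
      have := hq' 0 z
      simp only [q] at this
      rw [hs, ← hσ]
      omega)
    (by
      intro z
      rw [hs]
      exact hq' 1 z)
    (by
      intro z
      rw [hs]
      exact hq' 2 z)
  exact absurd (hmin T' hT') (not_le.2 hlt)

end Paths

/-! ### Few children -/

/-- Increase the first index of an address by `d` if it is larger than `a`. -/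
def shiftFrom (a d : ℕ) : List ℕ → List ℕ
  | [] => []
  | j :: t => (if a < j then j + d else j) :: t

theorem shiftFrom_injective (a d : ℕ) : (shiftFrom a d).Injective := by
  rintro (_ | ⟨i, s⟩) (_ | ⟨j, t⟩) h
  · rfl
  · simp [shiftFrom] at h
  · simp [shiftFrom] at h
  · simp only [shiftFrom, List.cons.injEq] at h ⊢
    refine ⟨?_, h.2⟩
    have := h.1
    split_ifs at this <;> omega

namespace SameRel

theorem append_congr {s s' t t' : List ℕ} (p : List ℕ) (h : SameRel s s' t t') :
    SameRel (p ++ s) (p ++ s') (p ++ t) (p ++ t') :=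
  (append_append p s s').trans (h.trans (append_append p t t').symm)

/-- The shift preserves the order of indices, so only adjacency can change, and only for the
children `a` and `a + 1`, between which the gap opens. -/
theorem shiftFrom {a d : ℕ} {s s' : List ℕ} (h : ¬ (s = [a] ∧ s' = [a + 1]))
    (h' : ¬ (s = [a + 1] ∧ s' = [a])) :
    SameRel s s' (shiftFrom a d s) (shiftFrom a d s') := by
  match s, s' with
  | [], [] => exact .refl _ _
  | [], j :: t =>
    refine ⟨by simp [_root_.shiftFrom], fun r => ?_⟩
    cases r <;> simp [_root_.shiftFrom]
  | j :: t, [] =>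
    refine ⟨by simp [_root_.shiftFrom], fun r => ?_⟩
    cases r <;> simp [_root_.shiftFrom]
  | i :: s, j :: t =>
    have h1 : i = j ↔ (if a < i then i + d else i) = if a < j then j + d else j := by
      split_ifs <;> omega
    have h2 : j = i ↔ (if a < j then j + d else j) = if a < i then i + d else i := by
      split_ifs <;> omega
    have h3 : i < j ↔ (if a < i then i + d else i) < if a < j then j + d else j := by
      split_ifs <;> omega
    have h4 : j < i ↔ (if a < j then j + d else j) < if a < i then i + d else i := by
      split_ifs <;> omega
    have h5 : (s = [] ∧ t = [] ∧ j = i + 1) ↔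
        s = [] ∧ t = [] ∧ (if a < j then j + d else j) = (if a < i then i + d else i) + 1 := by
      refine and_congr_right fun hs => and_congr_right fun ht => ?_
      subst hs ht
      simp only [List.cons.injEq, and_true] at h h'
      by_cases hd : d = 0
      · simp [hd]
      · split_ifs <;> omega
    have h6 : (t = [] ∧ s = [] ∧ i = j + 1) ↔
        t = [] ∧ s = [] ∧ (if a < i then i + d else i) = (if a < j then j + d else j) + 1 := by
      refine and_congr_right fun ht => and_congr_right fun hs => ?_
      subst hs ht
      simp only [List.cons.injEq, and_true] at h h'
      by_cases hd : d = 0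
      · simp [hd]
      · split_ifs <;> omega
    refine ⟨by simp only [_root_.shiftFrom, List.cons.injEq, ← h1], fun r => ?_⟩
    cases r <;> simp only [_root_.shiftFrom, Nav.down_cons_cons, Nav.downPlus_cons_cons,
      Nav.right_cons_cons, Nav.rightPlus_cons_cons, ← h1, ← h2, ← h3, ← h4, ← h5, ← h6, and_self]

/-- Strict descendants of children of `p` are seen in the same way by each node that is not below
these children. -/
theorem of_strict_grandchildren {p u : List ℕ} {j l : ℕ} {t t' : List ℕ} (ht : t ≠ [])
    (ht' : t' ≠ []) (hu : ∀ i s, u = p ++ i :: s → i ≠ j ∧ i ≠ l) :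
    SameRel u (p ++ j :: t) u (p ++ l :: t') := by
  by_cases hp : p <+: u
  · obtain ⟨s, rfl⟩ := hp
    refine append_congr p ?_
    match s with
    | [] =>
      refine ⟨by simp, fun r => ?_⟩
      cases r <;> simp [ht, ht']
    | i :: s =>
      obtain ⟨h1, h2⟩ := hu i s rfl
      refine ⟨by simp [h1, h2], fun r => ?_⟩
      cases r <;> simp [ht, ht', h1, h2, h1.symm, h2.symm]
  · exact of_not_prefix hp (by simp) (by simp)

/-- Two children of `p` are seen in the same way by each node that is neither below one of them nor
a child of `p` that separates them or is next to one of them. -/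
theorem of_children {p u : List ℕ} {j l : ℕ}
    (hu : ∀ i s, u = p ++ i :: s → i ≠ j ∧ i ≠ l ∧
      (s = [] → (i + 1 < j ∧ i + 1 < l) ∨ (j + 1 < i ∧ l + 1 < i))) :
    SameRel u (p ++ [j]) u (p ++ [l]) := by
  by_cases hp : p <+: u
  · obtain ⟨s, rfl⟩ := hp
    refine append_congr p ?_
    match s with
    | [] =>
      refine ⟨by simp, fun r => ?_⟩
      cases r <;> simp
    | i :: s =>
      obtain ⟨h1, h2, h3⟩ := hu i s rfl
      refine ⟨by simp [h1, h2], fun r => ?_⟩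
      have h4 : (s = [] ∧ j = i + 1 ↔ s = [] ∧ l = i + 1) := by
        refine and_congr_right fun hs => ?_
        have := h3 hs
        omega
      have h5 : (s = [] ∧ i = j + 1 ↔ s = [] ∧ i = l + 1) := by
        refine and_congr_right fun hs => ?_
        have := h3 hs
        omega
      have h6 : (s = [] ∧ i < j ↔ s = [] ∧ i < l) := by
        refine and_congr_right fun hs => ?_
        have := h3 hs
        omega
      have h7 : (s = [] ∧ j < i ↔ s = [] ∧ l < i) := by
        refine and_congr_right fun hs => ?_
        have := h3 hs
        omega
      cases r <;> simp [h1, h2, h1.symm, h2.symm, h4, h5, h6, h7]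
  · exact of_not_prefix hp (by simp) (by simp)

end SameRel

section Degrees

/-- The children of `p` to the left of the child with index `j`. -/
def leftOf (p : List ℕ) (j : ℕ) : Set (List ℕ) := {z | ∃ l < j, z = p ++ [l]}

/-- The children of `p` to the right of the right sibling of the child with index `j`. -/
def rightOf (p : List ℕ) (j : ℕ) : Set (List ℕ) := {z | ∃ l, j + 1 < l ∧ z = p ++ [l]}

/-- The strict descendants of the children of `p` up to index `j`. -/
def belowLeft (p : List ℕ) (j : ℕ) : Set (List ℕ) := {z | ∃ l ≤ j, ∃ t ≠ [], z = p ++ l :: t}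

/-- The strict descendants of the children of `p` with an index larger than `j`. -/
def belowRight (p : List ℕ) (j : ℕ) : Set (List ℕ) := {z | ∃ l, j < l ∧ ∃ t ≠ [], z = p ++ l :: t}

theorem leftOf_mono (p : List ℕ) : Monotone (leftOf p) :=
  fun _ _ h _ ⟨l, hl, hz⟩ => ⟨l, hl.trans_le h, hz⟩

theorem rightOf_anti (p : List ℕ) : Antitone (rightOf p) :=
  fun _ _ h _ ⟨l, hl, hz⟩ => ⟨l, by omega, hz⟩

theorem belowLeft_mono (p : List ℕ) : Monotone (belowLeft p) :=
  fun _ _ h _ ⟨l, hl, hz⟩ => ⟨l, hl.trans h, hz⟩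

theorem belowRight_anti (p : List ℕ) : Antitone (belowRight p) :=
  fun _ _ h _ ⟨l, hl, hz⟩ => ⟨l, h.trans_lt hl, hz⟩

variable {U : Type*} {φ : NormalForm U} {T : TreeStructure U}

/-- The subtrees of the children of `p` with indices from `a + 1` to `a + d` can be removed if the
cuts after the children with indices `a` and `a + d` look alike. -/
theorem exists_smaller_of_siblings (hT : T.Models φ.toFormula) {p : List ℕ} {a d : ℕ}
    (hd : 0 < d) (hc : ∀ {j}, j ≤ a + d + 1 → p ++ [j] ∈ T.dom)
    (htp : T.tp φ.toFormula.symbols ⟨p ++ [a], hc (by omega)⟩ =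
      T.tp φ.toFormula.symbols ⟨p ++ [a + d], hc (by omega)⟩)
    (htp_succ : T.tp φ.toFormula.symbols ⟨p ++ [a + 1], hc (by omega)⟩ =
      T.tp φ.toFormula.symbols ⟨p ++ [a + d + 1], hc (by omega)⟩)
    (hleft : ∀ z : T.Node,
      min (φ.C + 1) (T.count φ.toFormula.symbols (leftOf p a) (T.tp φ.toFormula.symbols z)) =
      min (φ.C + 1)
        (T.count φ.toFormula.symbols (leftOf p (a + d)) (T.tp φ.toFormula.symbols z)))
    (hright : ∀ z : T.Node,
      min (φ.C + 1)
        (T.count φ.toFormula.symbols (rightOf p (a + d)) (T.tp φ.toFormula.symbols z)) =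
      min (φ.C + 1) (T.count φ.toFormula.symbols (rightOf p a) (T.tp φ.toFormula.symbols z)))
    (hbelowLeft : ∀ z : T.Node,
      min (φ.C + 1) (T.count φ.toFormula.symbols (belowLeft p a) (T.tp φ.toFormula.symbols z)) =
      min (φ.C + 1)
        (T.count φ.toFormula.symbols (belowLeft p (a + d)) (T.tp φ.toFormula.symbols z)))
    (hbelowRight : ∀ z : T.Node,
      min (φ.C + 1)
        (T.count φ.toFormula.symbols (belowRight p (a + d)) (T.tp φ.toFormula.symbols z)) =
      min (φ.C + 1)
        (T.count φ.toFormula.symbols (belowRight p a) (T.tp φ.toFormula.symbols z))) :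
    ∃ T' : TreeStructure U, T'.Models φ.toFormula ∧ T'.dom.card < T.dom.card := by
  classical
  set σ := φ.toFormula.symbols with hσ
  set g : List ℕ → List ℕ := liftAt p (shiftFrom a d) with hg_def
  have hg : g.Injective := liftAt_injective (shiftFrom_injective a d)
  have hgp : g p = p := by
    simpa [shiftFrom] using liftAt_append (v := p) (f := shiftFrom a d) []
  have hg_not : ∀ {u}, ¬ p <+: u → g u = u := fun h => liftAt_of_not_prefix h
  have hg_le : ∀ {j t}, j ≤ a → g (p ++ j :: t) = p ++ j :: t := by
    intro j t hj
    simp [hg_def, shiftFrom, not_lt.2 hj]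
  have hg_gt : ∀ {j t}, a < j → g (p ++ j :: t) = p ++ (j + d) :: t := by
    intro j t hj
    simp [hg_def, shiftFrom, hj]
  -- The index `i` is the old index of the new child `j`. The next old index is larger by 1, except
  -- at `j = a`, where it jumps over the removed block.
  have hg_cons : ∀ j t, ∃ i, j ≤ i ∧ (i ≤ a ∨ a + d < i) ∧ g (p ++ j :: t) = p ++ i :: t ∧
      (g (p ++ (j + 1) :: t) = p ++ (i + 1) :: t ∨
        g (p ++ (j + 1) :: t) = p ++ (i + d + 1) :: t) := by
    intro j t
    by_cases hj : a < j
    · exact ⟨j + d, by omega, by omega, hg_gt hj, Or.inl (by rw [hg_gt (by omega)]; congr 2; omega)⟩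
    · refine ⟨j, le_rfl, by omega, hg_le (by omega), ?_⟩
      by_cases hj' : a < j + 1
      · exact Or.inr (by rw [hg_gt hj']; congr 2; omega)
      · exact Or.inl (hg_le (by omega))
  have hg_ne : ∀ {j t u}, a < j → j ≤ a + d → g u ≠ p ++ j :: t := by
    intro j t u hj hj' hu
    have hp : p <+: u := by
      rw [← prefix_liftAt_iff (f := shiftFrom a d), ← hg_def, hu]
      exact List.prefix_append _ _
    obtain ⟨_ | ⟨i, s⟩, rfl⟩ := hp
    · rw [List.append_nil, hgp] at hu
      simp at hu
    · obtain ⟨l, -, hl, h, -⟩ := hg_cons i s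
      rw [h] at hu
      simp only [List.append_cancel_left_eq, List.cons.injEq] at hu
      omega
  have hsnoc : ∀ {u : List ℕ} {k : ℕ}, ¬ p <+: u → g (u ++ [k]) = u ++ [k] := by
    intro u k h
    by_cases hk : p = u ++ [k]
    · rw [← hk, hgp]
    · refine hg_not fun hp => ?_
      rcases List.prefix_concat_iff.1 (by simpa using hp) with h1 | h1
      · exact hk (by simpa using h1)
      · exact h h1
  obtain ⟨T', hT'⟩ := T.exists_isComap g hg
    (by
      by_cases h : p <+: []
      · obtain rfl : p = [] := by simpa using h
        rw [hgp]; exact T.root_mem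
      · rw [hg_not h]; exact T.root_mem)
    (by
      intro u k h
      by_cases hu : p <+: u
      · obtain ⟨_ | ⟨j, t⟩, rfl⟩ := hu
        · rw [List.append_nil, hgp]
          exact T.mem_of_append_mem [0] (hc (by omega))
        · obtain ⟨i, -, -, hi, -⟩ := hg_cons j t
          obtain ⟨i', -, -, hi', -⟩ := hg_cons j (t ++ [k])
          obtain rfl : i = i' := by
            by_cases hj : a < j
            · rw [hg_gt hj] at hi hi'
              simp at hi hi'
              omega
            · rw [hg_le (by omega)] at hi hi'
              simp at hi hi'
              omega
          rw [List.append_assoc, List.cons_append, hi'] at h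
          rw [hi]
          exact T.parent_mem _ k (by simpa using h)
      · rw [hsnoc hu] at h
        rw [hg_not hu]
        exact T.parent_mem _ k h)
    (by
      intro u k h
      by_cases hu : p <+: u
      · obtain ⟨_ | ⟨j, t⟩, rfl⟩ := hu
        · rw [List.append_nil] at h ⊢
          obtain ⟨i, -, -, hi, hi' | hi'⟩ := hg_cons k []
          · rw [hi'] at h
            rw [hi]
            exact T.left_mem _ _ h
          · rw [hi'] at h
            rw [hi]
            exact T.sibling_mem_of_le (by omega) h
        · have key : ∃ i, ∀ s, g (p ++ j :: s) = p ++ i :: s := by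
            by_cases hj : a < j
            · exact ⟨j + d, fun s => hg_gt hj⟩
            · exact ⟨j, fun s => hg_le (by omega)⟩
          obtain ⟨i, hi⟩ := key
          rw [List.append_assoc, List.cons_append, hi] at h ⊢
          have := T.left_mem (p ++ i :: t) k (by simpa using h)
          simpa using this
      · rw [hsnoc hu] at h ⊢
        exact T.left_mem _ k h)
  refine ⟨T', ?_, hT'.card_lt hg (hc (j := a + 1) (by omega)) ?_⟩
  swap
  · rintro ⟨u, hu⟩
    exact hg_ne (by omega) (by omega) hu
  set γ := hT'.node with hγ
  have hγ_val : ∀ u, (γ u).1 = g u.1 := fun _ => rfl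
  have hγ_inj : γ.Injective := hT'.node_injective hg
  have hrel : ∀ {u u' : List ℕ}, ¬ (u = p ++ [a] ∧ u' = p ++ [a + 1]) →
      ¬ (u = p ++ [a + 1] ∧ u' = p ++ [a]) → SameRel u u' (g u) (g u') := by
    have aux : ∀ {u t : List ℕ}, ¬ p <+: u → SameRel u (p ++ t) (g u) (g (p ++ t)) := by
      intro u t hu
      rw [hg_not hu]
      match t with
      | [] => rw [List.append_nil, hgp]; exact .refl _ _
      | j :: t =>
        obtain ⟨i, -, -, hi, -⟩ := hg_cons j t
        rw [hi]
        exact .of_not_prefix hu (by simp) (by simp)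
    intro u u' h h'
    by_cases hu : p <+: u <;> by_cases hu' : p <+: u'
    · obtain ⟨t, rfl⟩ := hu
      obtain ⟨t', rfl⟩ := hu'
      rw [hg_def, liftAt_append, liftAt_append]
      refine SameRel.append_congr p (SameRel.shiftFrom ?_ ?_)
      · rintro ⟨rfl, rfl⟩; exact h ⟨rfl, rfl⟩
      · rintro ⟨rfl, rfl⟩; exact h' ⟨rfl, rfl⟩
    · obtain ⟨t, rfl⟩ := hu
      exact (aux hu').swap
    · obtain ⟨t, rfl⟩ := hu'
      exact aux hu
    · rw [hg_not hu, hg_not hu']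
      exact .refl _ _
  have hmem_le : ∀ {x : T.Node} {l t}, l ≤ a → x.1 = p ++ l :: t → x ∈ Set.range γ :=
    fun {x l t} hl hx => hT'.mem_range_node (p ++ l :: t) (by rw [hg_le hl, hx])
  have hmem_gt : ∀ {x : T.Node} {l t}, a + d < l → x.1 = p ++ l :: t → x ∈ Set.range γ :=
    fun {x l t} hl hx => hT'.mem_range_node (p ++ (l - d) :: t) (by
      rw [hg_gt (by omega), hx]; congr 2; omega)
  have hmissing : ∀ {z : T.Node}, z ∉ Set.range γ →
      ∃ j t, a < j ∧ j ≤ a + d ∧ z.1 = p ++ j :: t := by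
    intro z hz
    have hp : p <+: z.1 := by
      by_contra h
      exact hz (hT'.mem_range_node z.1 (hg_not h))
    obtain ⟨_ | ⟨j, t⟩, hj⟩ := hp
    · exact (hz (hT'.mem_range_node p (by rw [hgp, ← hj, List.append_nil]))).elim
    · refine ⟨j, t, ?_, ?_, hj.symm⟩
      · by_contra h
        exact hz (hmem_le (not_lt.1 h) hj.symm)
      · by_contra h
        exact hz (hmem_gt (not_le.1 h) hj.symm)
  -- The child `a + d` is not counted in `leftOf p (a + d)`, but it has the type of the child `a`,
  -- which is. On the right, `a + 1` and `a + d + 1` play these roles.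
  have hleft_lt : ∀ {z : T.Node} {j}, a ≤ j → j ≤ a + d → z.1 = p ++ [j] →
      φ.C + 1 ≤ T.count σ (leftOf p a) (T.tp σ z) := by
    have main : ∀ {z : T.Node} {j}, a ≤ j → j < a + d → z.1 = p ++ [j] →
        φ.C + 1 ≤ T.count σ (leftOf p a) (T.tp σ z) := by
      intro z j h h' hz
      refine T.lt_count_of_min_eq (leftOf_mono p (by omega)) (hleft z) ⟨j, h', hz⟩ ?_
      rintro ⟨l, hl, hl'⟩
      have := hl'.symm.trans hz
      simp at this
      omega
    intro z j h h' hz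
    rcases h'.eq_or_lt with rfl | h'
    · rw [show z = ⟨p ++ [a + d], hc (by omega)⟩ from Subtype.ext hz, ← htp]
      exact main le_rfl (by omega) rfl
    · exact main h h' hz
  have hright_lt : ∀ {z : T.Node} {j}, a + 1 ≤ j → j ≤ a + d + 1 → z.1 = p ++ [j] →
      φ.C + 1 ≤ T.count σ (rightOf p (a + d)) (T.tp σ z) := by
    have main : ∀ {z : T.Node} {j}, a + 1 < j → j ≤ a + d + 1 → z.1 = p ++ [j] →
        φ.C + 1 ≤ T.count σ (rightOf p (a + d)) (T.tp σ z) := by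
      intro z j h h' hz
      refine T.lt_count_of_min_eq (rightOf_anti p (by omega)) (hright z) ⟨j, h, hz⟩ ?_
      rintro ⟨l, hl, hl'⟩
      have := hl'.symm.trans hz
      simp at this
      omega
    intro z j h h' hz
    rcases h.eq_or_lt with rfl | h
    · rw [show z = ⟨p ++ [a + 1], hc (by omega)⟩ from Subtype.ext hz, htp_succ]
      exact main (by omega) le_rfl rfl
    · exact main h h' hz
  -- Copies of the removed nodes.
  have hcopy_below : ∀ (u : T'.Node) {z : T.Node} {j t}, a < j → j ≤ a + d → t ≠ [] →
      z.1 = p ++ j :: t → ∃ X : Set T.Node, φ.C + 1 ≤ X.ncard ∧ ∀ x ∈ X,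
        x ∈ Set.range γ ∧ (∃ l, ∃ t' ≠ [], x.1 = p ++ l :: t') ∧ Agree σ T (γ u) x T (γ u) z := by
    intro u z j t hj hj' ht hz
    -- Copies are taken on the side of the gap that does not contain `u`, so that `u` is in neither
    -- of the two subtrees compared.
    by_cases hu : ∃ i s, a < i ∧ u.1 = p ++ i :: s
    · obtain ⟨i, s, hi, hu⟩ := hu
      refine ⟨_, T.lt_count_of_min_eq (belowLeft_mono p (Nat.le_add_right a d)) (hbelowLeft z)
        ⟨j, hj', t, ht, hz⟩ ?_, ?_⟩
      · rintro ⟨l, hl, t', -, h⟩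
        have := h.symm.trans hz
        simp at this
        omega
      · rintro x ⟨⟨l, hl, t', ht', hx⟩, hxz⟩
        refine ⟨hmem_le hl hx, ⟨l, t', ht', hx⟩, .of_tp_eq rfl hxz ?_⟩
        rw [hx, hz, hγ_val, hu, hg_gt hi]
        refine .of_strict_grandchildren ht' ht fun i' s' h => ?_
        simp at h
        omega
    · refine ⟨_, T.lt_count_of_min_eq (belowRight_anti p (Nat.le_add_right a d)) (hbelowRight z)
        ⟨j, hj, t, ht, hz⟩ ?_, ?_⟩
      · rintro ⟨l, hl, t', -, h⟩
        have := h.symm.trans hz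
        simp at this
        omega
      · rintro x ⟨⟨l, hl, t', ht', hx⟩, hxz⟩
        refine ⟨hmem_gt hl hx, ⟨l, t', ht', hx⟩, .of_tp_eq rfl hxz ?_⟩
        rw [hx, hz, hγ_val]
        refine .of_strict_grandchildren ht' ht fun i s h => ?_
        by_cases hp : p <+: u.1
        · obtain ⟨_ | ⟨i', s'⟩, hu'⟩ := hp
          · rw [← hu', List.append_nil, hgp] at h
            simp at h
          · have hi' : i' ≤ a := by
              by_contra hi'
              exact hu ⟨i', s', by omega, hu'.symm⟩
            rw [← hu', hg_le hi'] at h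
            simp at h
            omega
        · rw [hg_not hp] at h
          exact (hp ⟨_, h.symm⟩).elim
  have hagree : ∀ {u u' : T'.Node}, ¬ (u.1 = p ++ [a] ∧ u'.1 = p ++ [a + 1]) →
      ¬ (u.1 = p ++ [a + 1] ∧ u'.1 = p ++ [a]) → Agree σ T' u u' T (γ u) (γ u') := fun h h' =>
    .of_tp_eq (hT'.tp_node σ _) (hT'.tp_node σ _) (hrel h h')
  have hg_a : g (p ++ [a]) = p ++ [a] := hg_le le_rfl
  have hg_a' : g (p ++ [a + 1]) = p ++ [a + d + 1] := by
    rw [hg_gt (by omega)]; congr 2; omega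
  -- The children `a` and `a + d + 1` become adjacent. By the type assumptions this new pair looks
  -- like the old pair `a`, `a + 1`, and also like `a + d`, `a + d + 1`.
  have hagree_left : ∀ {u u' : T'.Node}, u.1 = p ++ [a] → u'.1 = p ++ [a + 1] →
      Agree σ T' u u' T (γ u) ⟨p ++ [a + 1], hc (by omega)⟩ := by
    intro u u' h h'
    have hu' : γ u' = ⟨p ++ [a + d + 1], hc (by omega)⟩ := Subtype.ext (by rw [hγ_val, h', hg_a'])
    refine .of_tp_eq (hT'.tp_node σ _) ?_ ?_
    · rw [htp_succ, ← hu']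
      exact hT'.tp_node σ _
    · rw [hγ_val, h, h', hg_a]
      exact .refl _ _
  have hagree_right : ∀ {u u' : T'.Node}, u.1 = p ++ [a + 1] → u'.1 = p ++ [a] →
      Agree σ T' u u' T (γ u) ⟨p ++ [a + d], hc (by omega)⟩ := by
    intro u u' h h'
    have hu' : γ u' = ⟨p ++ [a], hc (by omega)⟩ := Subtype.ext (by rw [hγ_val, h', hg_a])
    refine .of_tp_eq (hT'.tp_node σ _) ?_ ?_
    · rw [← htp, ← hu']
      exact hT'.tp_node σ _
    · rw [hγ_val, h, h', hg_a']
      refine SameRel.append_congr p ⟨by simp, fun r => ?_⟩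
      cases r <;> simp
      omega
  -- Redirecting one node of `T'` to a removed node.
  have hredirect : ∀ {y : List ℕ} {w : T.Node}, w ∉ Set.range γ →
      ∃ η : T'.Node → T.Node, η.Injective ∧ (∀ u, u.1 = y → η u = w) ∧
        (∀ u, u.1 ≠ y → η u = γ u) ∧ ∀ x ∈ Set.range γ, x.1 ≠ g y → x ∈ Set.range η := by
    intro y w hw
    refine ⟨fun u => if u.1 = y then w else γ u, ?_, fun u h => if_pos h, fun u h => if_neg h, ?_⟩
    · intro u u' h
      by_cases hu : u.1 = y <;> by_cases hu' : u'.1 = y <;> simp only [hu, hu', if_true, if_false] at h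
      · exact Subtype.ext (hu.trans hu'.symm)
      · exact (hw ⟨u', h.symm⟩).elim
      · exact (hw ⟨u, h⟩).elim
      · exact hγ_inj h
    · rintro _ ⟨u, rfl⟩ hne
      refine ⟨u, if_neg ?_⟩
      rintro rfl
      exact hne rfl
  refine NormalForm.models_of_agree hT (fun u u' => ?_) (fun u i => ⟨γ u, ?_⟩)
  · by_cases h : u.1 = p ++ [a] ∧ u'.1 = p ++ [a + 1]
    · exact ⟨_, _, hagree_left h.1 h.2⟩
    · by_cases h' : u.1 = p ++ [a + 1] ∧ u'.1 = p ++ [a]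
      · exact ⟨_, _, hagree_right h'.1 h'.2⟩
      · exact ⟨_, _, hagree h h'⟩
  have hne : p ++ [a] ≠ p ++ [a + 1] := by simp
  by_cases hu : u.1 = p ++ [a]
  · have hγu : (γ u).1 = p ++ [a] := by rw [hγ_val, hu, hg_a]
    -- The child `a` sees its new right sibling as the old child `a + 1`. In exchange the old child
    -- `a + d + 1` counts as lost; its copies lie farther right and so are not adjacent to `a`.
    obtain ⟨η, hη, hη_eq, hη_ne, hη_range⟩ := hredirect (y := p ++ [a + 1])
      (w := ⟨p ++ [a + 1], hc (by omega)⟩)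
      (by rintro ⟨u, hu⟩; exact hg_ne (by omega) (by omega) (congrArg Subtype.val hu))
    rw [hg_a'] at hη_range
    refine min_ncard_witnesses_eq (σ := σ) η hη (fun u' => ?_) (fun z hz => ?_)
      (φ.chiC_qf i) (φ.chiC_symbols_subset i)
    · by_cases hu' : u'.1 = p ++ [a + 1]
      · rw [hη_eq u' hu']
        exact hagree_left hu hu'
      · rw [hη_ne u' hu']
        exact hagree (fun h => hu' h.2) (fun h => hne (hu.symm.trans h.1))
    · have hz' : (∃ j t, a < j ∧ j ≤ a + d ∧ t ≠ [] ∧ z.1 = p ++ j :: t) ∨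
          ∃ j, a + 1 < j ∧ j ≤ a + d + 1 ∧ z.1 = p ++ [j] := by
        by_cases hzb : z.1 = p ++ [a + d + 1]
        · exact Or.inr ⟨_, by omega, le_rfl, hzb⟩
        · obtain ⟨j, t, hj, hj', hzj⟩ := hmissing (fun h => hz (hη_range z h hzb))
          by_cases ht : t = []
          · subst ht
            refine Or.inr ⟨j, lt_of_le_of_ne hj ?_, by omega, hzj⟩
            rintro rfl
            refine hz ⟨⟨p ++ [a + 1], (hT'.mem_iff _).2 (by rw [hg_a']; exact hc (by omega))⟩, ?_⟩
            rw [hη_eq _ rfl]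
            exact Subtype.ext hzj.symm
          · exact Or.inl ⟨j, t, hj, hj', ht, hzj⟩
      rcases hz' with ⟨j, t, hj, hj', ht, hzj⟩ | ⟨j, hj, hj', hzj⟩
      · obtain ⟨X, hX, h⟩ := hcopy_below u hj hj' ht hzj
        refine ⟨X, hX, fun x hx => ?_⟩
        obtain ⟨h1, ⟨l, t', ht', hxl⟩, h2⟩ := h x hx
        refine ⟨hη_range x h1 ?_, h2⟩
        rw [hxl]
        simp [ht']
      · refine ⟨_, hright_lt hj.le hj' hzj, ?_⟩
        rintro x ⟨⟨l, hl, hxl⟩, hxz⟩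
        refine ⟨hη_range x (hmem_gt (by omega) hxl) (by rw [hxl]; simp; omega),
          .of_tp_eq rfl hxz ?_⟩
        rw [hxl, hzj, hγu]
        refine .of_children fun i s h => ?_
        simp at h
        obtain ⟨rfl, rfl⟩ := h
        refine ⟨by omega, by omega, fun _ => by omega⟩
  by_cases hu₁ : u.1 = p ++ [a + 1]
  · have hγu : (γ u).1 = p ++ [a + d + 1] := by rw [hγ_val, hu₁, hg_a']
    obtain ⟨η, hη, hη_eq, hη_ne, hη_range⟩ := hredirect (y := p ++ [a])
      (w := ⟨p ++ [a + d], hc (by omega)⟩)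
      (by rintro ⟨u, hu⟩; exact hg_ne (by omega) (by omega) (congrArg Subtype.val hu))
    rw [hg_a] at hη_range
    refine min_ncard_witnesses_eq (σ := σ) η hη (fun u' => ?_) (fun z hz => ?_)
      (φ.chiC_qf i) (φ.chiC_symbols_subset i)
    · by_cases hu' : u'.1 = p ++ [a]
      · rw [hη_eq u' hu']
        exact hagree_right hu₁ hu'
      · rw [hη_ne u' hu']
        exact hagree (fun h => hu h.1) (fun h => hu' h.2)
    · have hz' : (∃ j t, a < j ∧ j ≤ a + d ∧ t ≠ [] ∧ z.1 = p ++ j :: t) ∨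
          ∃ j, a ≤ j ∧ j < a + d ∧ z.1 = p ++ [j] := by
        by_cases hza : z.1 = p ++ [a]
        · exact Or.inr ⟨_, le_rfl, by omega, hza⟩
        · obtain ⟨j, t, hj, hj', hzj⟩ := hmissing (fun h => hz (hη_range z h hza))
          by_cases ht : t = []
          · subst ht
            refine Or.inr ⟨j, hj.le, lt_of_le_of_ne hj' ?_, hzj⟩
            rintro rfl
            refine hz ⟨⟨p ++ [a], (hT'.mem_iff _).2 (by rw [hg_a]; exact hc (by omega))⟩, ?_⟩
            rw [hη_eq _ rfl]
            exact Subtype.ext hzj.symm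
          · exact Or.inl ⟨j, t, hj, hj', ht, hzj⟩
      rcases hz' with ⟨j, t, hj, hj', ht, hzj⟩ | ⟨j, hj, hj', hzj⟩
      · obtain ⟨X, hX, h⟩ := hcopy_below u hj hj' ht hzj
        refine ⟨X, hX, fun x hx => ?_⟩
        obtain ⟨h1, ⟨l, t', ht', hxl⟩, h2⟩ := h x hx
        refine ⟨hη_range x h1 ?_, h2⟩
        rw [hxl]
        simp [ht']
      · refine ⟨_, hleft_lt hj hj'.le hzj, ?_⟩
        rintro x ⟨⟨l, hl, hxl⟩, hxz⟩
        refine ⟨hη_range x (hmem_le hl.le hxl) (by rw [hxl]; simp; omega), .of_tp_eq rfl hxz ?_⟩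
        rw [hxl, hzj, hγu]
        refine .of_children fun i s h => ?_
        simp at h
        obtain ⟨rfl, rfl⟩ := h
        refine ⟨by omega, by omega, fun _ => by omega⟩
  refine min_ncard_witnesses_eq (σ := σ) γ hγ_inj
    (fun u' => hagree (fun h => hu h.1) (fun h => hu₁ h.1)) (fun z hz => ?_)
    (φ.chiC_qf i) (φ.chiC_symbols_subset i)
  obtain ⟨j, t, hj, hj', hzj⟩ := hmissing hz
  by_cases ht : t = []
  · subst ht
    -- Again the copies are on the side away from `u`. Since `u` is not one of the two children at
    -- the cut, neither the lost child nor its copies are adjacent to it.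
    by_cases hui : ∃ i s, a < i ∧ u.1 = p ++ i :: s
    · obtain ⟨i, s, hi, hui⟩ := hui
      refine ⟨_, hleft_lt hj.le hj' hzj, ?_⟩
      rintro x ⟨⟨l, hl, hxl⟩, hxz⟩
      refine ⟨hmem_le hl.le hxl, .of_tp_eq rfl hxz ?_⟩
      rw [hxl, hzj, hγ_val, hui, hg_gt hi]
      refine .of_children fun i' s' h => ?_
      simp at h
      refine ⟨by omega, by omega, fun hs => Or.inr ?_⟩
      have : i ≠ a + 1 := by
        rintro rfl
        exact hu₁ (by rw [hui, h.2, hs])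
      omega
    · refine ⟨_, hright_lt hj (by omega) hzj, ?_⟩
      rintro x ⟨⟨l, hl, hxl⟩, hxz⟩
      refine ⟨hmem_gt (by omega) hxl, .of_tp_eq rfl hxz ?_⟩
      rw [hxl, hzj, hγ_val]
      refine .of_children fun i s h => ?_
      by_cases hp : p <+: u.1
      · obtain ⟨_ | ⟨i', s'⟩, hu'⟩ := hp
        · rw [← hu', List.append_nil, hgp] at h
          simp at h
        · have hi' : i' ≤ a := by
            by_contra hi'
            exact hui ⟨i', s', by omega, hu'.symm⟩
          rw [← hu', hg_le hi'] at h
          simp at h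
          refine ⟨by omega, by omega, fun hs => Or.inl ?_⟩
          have : i' ≠ a := by
            rintro rfl
            exact hu (by rw [← hu', h.2, hs])
          omega
      · rw [hg_not hp] at h
        exact (hp ⟨_, h.symm⟩).elim
  · obtain ⟨X, hX, h⟩ := hcopy_below u hj hj' ht hzj
    exact ⟨X, hX, fun x hx => ⟨(h x hx).1, (h x hx).2.2⟩⟩

/-- Child indices form an initial segment: if `j` is missing, all children have indices below `j`,
so there are at most `j` of them. -/
theorem TreeFrame.child_mem_of_lt_degree {T : TreeFrame} {v : T.Node} {j : ℕ}
    (h : j < T.degree v) : v.1 ++ [j] ∈ T.dom := by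
  by_contra hj
  refine absurd h (not_lt.2 ?_)
  rw [TreeFrame.degree, ← Set.ncard_image_of_injective _ Subtype.val_injective]
  have hsub : Subtype.val '' {w : T.Node | T.Child v w} ⊆
      ((Finset.range j).image fun k => v.1 ++ [k] : Finset (List ℕ)) := by
    rintro _ ⟨w, ⟨k, hk⟩, rfl⟩
    rw [Finset.mem_coe, Finset.mem_image]
    refine ⟨k, Finset.mem_range.2 (not_le.1 fun hjk => hj ?_), hk.symm⟩
    exact T.sibling_mem_of_le hjk (hk ▸ w.2)
  refine (Set.ncard_le_ncard hsub (Finset.finite_toSet _)).trans ?_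
  rw [Set.ncard_coe_finset]
  exact Finset.card_image_le.trans (by simp)

/-- In a smallest model of a formula with a positive counting bound, degrees are small. -/
theorem degree_le (hT : T.Models φ.toFormula)
    (hmin : ∀ T' : TreeStructure U, T'.Models φ.toFormula → T.dom.card ≤ T'.dom.card)
    (hC : 1 ≤ φ.C) (v : T.Node) :
    T.degree v ≤ (4 * φ.C ^ 2 + 8 * φ.C) * φ.numOneTypes ^ 5 := by
  classical
  by_contra! hlong
  set σ := φ.toFormula.symbols with hσ
  have hfin := oneTypes_finite (Formula.symbols_finite φ.toFormula)
  let _ : Fintype (oneTypes σ) := hfin.fintype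
  have hN : Fintype.card (oneTypes σ) = φ.numOneTypes := by
    rw [NormalForm.numOneTypes, ← Nat.card_coe_set_eq, Nat.card_eq_fintype_card]
  -- With `n + 1` children there are `n` cuts between neighbours; the key of a cut records the types
  -- on both of its sides.
  obtain ⟨n, hn⟩ : ∃ n, T.degree v = n + 1 := ⟨T.degree v - 1, by omega⟩
  have hc : ∀ {j}, j ≤ n → v.1 ++ [j] ∈ T.dom := fun h =>
    TreeFrame.child_mem_of_lt_degree (by omega)
  let key : Fin n → oneTypes σ × oneTypes σ := fun j =>
    (⟨T.tp σ ⟨v.1 ++ [j.1], hc j.2.le⟩, T.tp_mem_oneTypes _⟩,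
      ⟨T.tp σ ⟨v.1 ++ [j.1 + 1], hc j.2⟩, T.tp_mem_oneTypes _⟩)
  let q : Fin 4 × oneTypes σ → Fin n → ℕ := fun p j =>
    match p with
    | (0, α) => min (φ.C + 1) (T.count σ (leftOf v.1 j) α)
    | (1, α) => φ.C + 1 - min (φ.C + 1) (T.count σ (rightOf v.1 j) α)
    | (2, α) => min (φ.C + 1) (T.count σ (belowLeft v.1 j) α)
    | (3, α) => φ.C + 1 - min (φ.C + 1) (T.count σ (belowRight v.1 j) α)
  obtain ⟨a, b, hab, hkey, hq⟩ := exists_lt_map_eq_of_monotone (B := φ.C + 1) key q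
    (by
      rintro ⟨k, α⟩ a b hab
      fin_cases k
      · exact min_le_min_left _ (T.count_mono (leftOf_mono _ hab) _)
      · exact Nat.sub_le_sub_left (min_le_min_left _ (T.count_mono (rightOf_anti _ hab) _)) _
      · exact min_le_min_left _ (T.count_mono (belowLeft_mono _ hab) _)
      · exact Nat.sub_le_sub_left (min_le_min_left _ (T.count_mono (belowRight_anti _ hab) _)) _)
    (by
      rintro ⟨k, α⟩ j
      fin_cases k
      · exact min_le_left _ _
      · exact Nat.sub_le _ _
      · exact min_le_left _ _
      · exact Nat.sub_le _ _)
    (by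
      have hN1 : 1 ≤ φ.numOneTypes := by
        rw [← hN]
        exact Fintype.card_pos_iff.2 ⟨⟨_, T.tp_mem_oneTypes ⟨[], T.root_mem⟩⟩⟩
      simp only [Fintype.card_prod, Fintype.card_fin, hN]
      rw [hn] at hlong
      generalize φ.numOneTypes = N at hlong hN1
      generalize φ.C = c at hlong hC
      have h1 : N ^ 2 ≤ N ^ 3 := Nat.pow_le_pow_right hN1 (by norm_num)
      have h2 : N ^ 3 ≤ N ^ 5 := Nat.pow_le_pow_right hN1 (by norm_num)
      have h3 : 1 ≤ N ^ 3 := Nat.one_le_pow _ _ hN1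
      -- This is where `1 ≤ C` is needed; the inequality fails for `c = 0`.
      have h4 : 4 * c + 8 ≤ 4 * c ^ 2 + 8 * c := by nlinarith
      have h5 : (4 * c + 8) * N ^ 3 ≤ (4 * c ^ 2 + 8 * c) * N ^ 5 := Nat.mul_le_mul h4 h2
      have h6 : N * N * (4 * N * (c + 1) + 1) = (4 * c + 4) * N ^ 3 + N ^ 2 := by ring
      have h7 : (4 * c + 8) * N ^ 3 = (4 * c + 4) * N ^ 3 + 4 * N ^ 3 := by ring
      omega)
  obtain ⟨d, hd⟩ : ∃ d, b.1 = a.1 + d := ⟨b.1 - a.1, by have : a.1 < b.1 := hab; omega⟩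
  have hd0 : 0 < d := by have : a.1 < b.1 := hab; omega
  have hbn := b.2
  simp only [key, Prod.mk.injEq, Subtype.mk.injEq] at hkey
  have hq' : ∀ k (z : T.Node), q (k, ⟨T.tp σ z, T.tp_mem_oneTypes z⟩) a =
    q (k, ⟨T.tp σ z, T.tp_mem_oneTypes z⟩) b := fun k z => hq _
  simp only [q, hd] at hq'
  simp only [hd] at hkey
  obtain ⟨T', hT', hlt⟩ := exists_smaller_of_siblings hT (p := v.1) (a := a.1) (d := d) hd0
    (fun h => hc (by omega)) hkey.1 hkey.2 (hq' 0)
    (fun z => by have := hq' 1 z; simp only at this; rw [← hσ]; omega) (hq' 2)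
    (fun z => by have := hq' 3 z; simp only at this; rw [← hσ]; omega)
  exact absurd (hmin T' hT') (not_le.2 hlt)

/-- In a smallest model of a formula without positive counting bounds, the root is the only node. -/
theorem degree_eq_zero (hT : T.Models φ.toFormula)
    (hmin : ∀ T' : TreeStructure U, T'.Models φ.toFormula → T.dom.card ≤ T'.dom.card)
    (hC : φ.C = 0) (v : T.Node) : T.degree v = 0 := by
  -- If all bounds are `0`, the conjuncts with `≥` are void and those with `≤` are universal, so the
  -- formula passes to the substructure consisting of the root.
  let T' : TreeStructure U :=
    { dom := {[]}
      root_mem := by simp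
      parent_mem := by simp
      left_mem := by simp
      pred := fun A _ => T.pred A ⟨[], T.root_mem⟩ }
  have hnil : ∀ u : T'.Node, u.1 = [] := fun u => Finset.mem_singleton.1 u.2
  have hagree : ∀ u u' : T'.Node, Agree φ.toFormula.symbols T' u u' T ⟨[], T.root_mem⟩
      ⟨[], T.root_mem⟩ := by
    intro u u'
    refine .of_tp_eq (TreeStructure.tp_eq_of_pred_iff fun A _ => Iff.rfl)
      (TreeStructure.tp_eq_of_pred_iff fun A _ => Iff.rfl) ?_
    rw [hnil u, hnil u']
    exact .refl _ _
  have hT' : T'.Models φ.toFormula := by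
    rw [NormalForm.models_iff] at hT ⊢
    refine ⟨fun u u' => ((hagree u u').holds_iff φ.chi_qf φ.chi_symbols_subset).2 (hT.1 _ _),
      fun i u => ?_⟩
    have h0 : φ.bound i = 0 := by
      have := φ.bound_le_C i
      omega
    have h := hT.2 i ⟨[], T.root_mem⟩
    cases hc : φ.cmp i
    · simp only [hc, Cmp.Sat, h0, Nat.le_zero, Set.ncard_eq_zero (Set.toFinite _)] at h ⊢
      refine Set.eq_empty_of_forall_notMem fun u' hu' => ?_
      exact Set.eq_empty_iff_forall_notMem.1 h _
        (((hagree u u').holds_iff (φ.chiC_qf i) (φ.chiC_symbols_subset i)).1 hu')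
    · simp [Cmp.Sat, h0]
  have hcard : T.dom.card ≤ 1 := hmin T' hT'
  by_contra h
  have h1 := TreeFrame.child_mem_of_lt_degree (Nat.pos_of_ne_zero h)
  have := Finset.card_le_one.1 hcard _ h1 _ T.root_mem
  simp at this

end Degrees

/-! ### Both bounds in a smallest model -/

theorem theorem3 {U : Type*} (φ : NormalForm U) (hφ : φ.toFormula.Satisfiable) :
    ∃ T : TreeStructure U, T.Models φ.toFormula ∧
      (∀ P : List T.Node, T.IsDownPath P →
        P.length ≤ 3 * (φ.C + 2) ^ (10 * φ.m + 1) * φ.numOneTypes ^ 2) ∧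
      (∀ v : T.Node, T.degree v ≤ (4 * φ.C ^ 2 + 8 * φ.C) * φ.numOneTypes ^ 5) := by
  classical
  obtain ⟨T, hT, hmin⟩ : ∃ T : TreeStructure U, T.Models φ.toFormula ∧
      ∀ T' : TreeStructure U, T'.Models φ.toFormula → T.dom.card ≤ T'.dom.card := by
    have hex : ∃ n, ∃ T : TreeStructure U, T.Models φ.toFormula ∧ T.dom.card = n :=
      let ⟨T, hT⟩ := hφ
      ⟨_, T, hT, rfl⟩
    obtain ⟨T, hT, hn⟩ := Nat.find_spec hex
    exact ⟨T, hT, fun T' hT' => hn ▸ Nat.find_min' hex ⟨T', hT', rfl⟩⟩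
  refine ⟨T, hT, fun P hP => length_le_of_isDownPath hT hmin hP, fun v => ?_⟩
  -- For `C = 0` the degree bound is `0`, which the pigeonhole argument cannot give.
  rcases Nat.eq_zero_or_pos φ.C with hC | hC
  · exact (degree_eq_zero hT hmin hC v).trans_le (Nat.zero_le _)
  · exact degree_le hT hmin hC v
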